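/- Let $\tau=(t_1,t_2,t_3,t_4,t_5,t_7)$ and, for $(s_3,\tau)\in\mathbf C^7$, let $$\tilde f=\tilde f_{(s_3,\tau)}(x,y,z)=y^3+x^3y+t_7x+t_5x^2+t_3x^3+t_1x^4+y(t_4x+t_2x^2)+s_3y^2-z^2 ,$$ and let $\tilde{\mathcal F}$ be the family of the surfaces $\{\tilde f_{(s_3,\tau)}=0\}\subset\mathbf C^3$. Let $C_{\tilde f}\subset\mathbf C^7$ be the set of those $(s_3,\tau)$ for which there is $(x,y,z)\in\mathbf C^3$ with $\tilde f=\partial_x\tilde f=\partial_y\tilde f=\partial_z\tilde f=0$, i.e. for which the surface is singular. Let $R=\mathbf C[s_3,t_1,t_2,t_3,t_4,t_5,t_7]$. For $a_1,\dots,a_7$, $b_1,\dots,b_9$, $c_1,\dots,c_{13}\in R$ put $$g_1=(a_1+a_2x+a_3x^2+a_4x^3+a_5x^4)+(a_6+a_7x)y,$$ $$g_2=(b_1x+b_2x^2)+(b_3+b_4x+b_5x^2+b_6x^3)y+(b_7+b_8x+b_9x^2)y^2,$$ $$g_3=(c_1+c_2x+\dots+c_6x^5)+(c_7+c_8x+c_9x^2+c_{10}x^3+c_{11}x^4)y+(c_{12}+c_{13}x)y^2,$$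 $$H=g_1\tilde f+g_2\,\partial_x\tilde f+g_3\,\partial_y\tilde f-\tfrac12\,z\,g_1\,\partial_z\tilde f .$$ Theorem. There is exactly one $7\times7$ matrix $A=(A_{ij})$ over $R$ such that for all $a_1,\dots,a_7\in R$ one can choose the $b_j,c_k\in R$ so that $$H=\sum_{i=1}^7a_i\Big(\sum_{j=1}^4A_{ij}x^j+\sum_{k=1}^3A_{i,k+4}x^{k-1}y\Big).$$ For this matrix $A$, there is a polynomial $\tilde\delta=\tilde\delta(s_3,\tau)\in R$ with the following properties. (i) There is a non-zero constant $k_0\in\mathbf C$ such that $\det A=k_0t_7\tilde\delta$. (ii) $\tilde\delta=t_7^7+\sum_{j=1}^7\tilde A_j(s_3,t_1,\dots,t_5)\,t_7^{7-j}$ with polynomials $\tilde A_j$. (iii) $\tilde\delta$ is irreducible as a polynomial of $(s_3,\tau)$ over $\mathbf C$. (iv) $C_{\tilde f}=\{(s_3,\tau)\in\mathbf C^7\mid t_7\tilde\delta(s_3,\tau)=0\}$. (v) There is a polynomial $\delta_{\rm ST34}$ of $\tau$ such that $\tilde\delta(0,\tau)=t_7\,\delta_{\rm ST34}(\tau)$.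 -/

import Mathlib

open MvPolynomial

noncomputable section

namespace E7Family

/-- The parameter ring `ℂ[s₃, t₁, t₂, t₃, t₄, t₅, t₇]`: the variables are numbered
`0 ↦ s₃`, `j ↦ t_j` for `1 ≤ j ≤ 5`, and `6 ↦ t₇`. -/
abbrev ParamRing : Type := MvPolynomial (Fin 7) ℂ

/-- The polynomial
`f(x,y,z) = y³ + x³y + t₇x + t₅x² + t₃x³ + t₁x⁴ + y(t₄x + t₂x²) + s₃y² - z²`
with parameters `p = (s₃, t₁, t₂, t₃, t₄, t₅, t₇)` in a commutative ring `R`.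
The variables `x, y, z` are `X 0, X 1, X 2`. -/
def familyPoly {R : Type*} [CommRing R] (p : Fin 7 → R) : MvPolynomial (Fin 3) R :=
  X 1 ^ 3 + X 0 ^ 3 * X 1 + C (p 6) * X 0 + C (p 5) * X 0 ^ 2 + C (p 3) * X 0 ^ 3
    + C (p 1) * X 0 ^ 4 + X 1 * (C (p 4) * X 0 + C (p 2) * X 0 ^ 2)
    + C (p 0) * X 1 ^ 2 - X 2 ^ 2

/-- The set of parameters in `ℂ⁷` for which the surface `f = 0` in `ℂ³` has a singular point. -/
def singularParams : Set (Fin 7 → ℂ) :=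
  {p | ∃ v : Fin 3 → ℂ, eval v (familyPoly p) = 0 ∧
    eval v (pderiv 0 (familyPoly p)) = 0 ∧
    eval v (pderiv 1 (familyPoly p)) = 0 ∧
    eval v (pderiv 2 (familyPoly p)) = 0}

/-- `f` as a polynomial in `x, y, z` whose coefficients are polynomials in the parameters. -/
def genericPoly : MvPolynomial (Fin 3) ParamRing :=
  familyPoly (fun i => (X i : ParamRing))

/-- `g₁ = M₀ + M₁ y` with `M₀ = a₁ + a₂x + a₃x² + a₄x³ + a₅x⁴` and `M₁ = a₆ + a₇x`
(the coefficient `a_i` is `a (i - 1)`). -/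
def ansatz₁ (a : Fin 7 → ParamRing) : MvPolynomial (Fin 3) ParamRing :=
  (C (a 0) + C (a 1) * X 0 + C (a 2) * X 0 ^ 2 + C (a 3) * X 0 ^ 3 + C (a 4) * X 0 ^ 4)
    + (C (a 5) + C (a 6) * X 0) * X 1

/-- `g₂ = N₀ + N₁ y + N₂ y²` with `N₀ = b₁x + b₂x²`, `N₁ = b₃ + b₄x + b₅x² + b₆x³`,
`N₂ = b₇ + b₈x + b₉x²`. -/
def ansatz₂ (b : Fin 9 → ParamRing) : MvPolynomial (Fin 3) ParamRing :=
  (C (b 0) * X 0 + C (b 1) * X 0 ^ 2)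
    + (C (b 2) + C (b 3) * X 0 + C (b 4) * X 0 ^ 2 + C (b 5) * X 0 ^ 3) * X 1
    + (C (b 6) + C (b 7) * X 0 + C (b 8) * X 0 ^ 2) * X 1 ^ 2

/-- `g₃ = P₀ + P₁ y + P₂ y²` with `P₀ = c₁ + c₂x + c₃x² + c₄x³ + c₅x⁴ + c₆x⁵`,
`P₁ = c₇ + c₈x + c₉x² + c₁₀x³ + c₁₁x⁴`, `P₂ = c₁₂ + c₁₃x`. -/
def ansatz₃ (c : Fin 13 → ParamRing) : MvPolynomial (Fin 3) ParamRing :=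
  (C (c 0) + C (c 1) * X 0 + C (c 2) * X 0 ^ 2 + C (c 3) * X 0 ^ 3 + C (c 4) * X 0 ^ 4
      + C (c 5) * X 0 ^ 5)
    + (C (c 6) + C (c 7) * X 0 + C (c 8) * X 0 ^ 2 + C (c 9) * X 0 ^ 3
      + C (c 10) * X 0 ^ 4) * X 1
    + (C (c 11) + C (c 12) * X 0) * X 1 ^ 2

/-- `H = g₁ f + g₂ ∂ₓf + g₃ ∂_y f - ½ z g₁ ∂_z f`. In this combination `z` cancels: with
`g = f + z²` one has `H = g₁ g + g₂ ∂ₓg + g₃ ∂_y g`. -/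
def combination (a : Fin 7 → ParamRing) (b : Fin 9 → ParamRing) (c : Fin 13 → ParamRing) :
    MvPolynomial (Fin 3) ParamRing :=
  ansatz₁ a * genericPoly + ansatz₂ b * pderiv 0 genericPoly + ansatz₃ c * pderiv 1 genericPoly
    - (1 / 2 : ℂ) • (X 2 * ansatz₁ a * pderiv 2 genericPoly)

/-- The seven monomials `x, x², x³, x⁴, y, xy, x²y`. -/
def targetMonomial : Fin 7 → MvPolynomial (Fin 3) ParamRing :=
  ![X 0, X 0 ^ 2, X 0 ^ 3, X 0 ^ 4, X 1, X 0 * X 1, X 0 ^ 2 * X 1]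

/-- `A` is the result of the elimination: for all `a₁, …, a₇` the coefficients `b_j` and `c_k` can
be chosen, as polynomials in the parameters, so that
`H = ∑ᵢ aᵢ (A_{i1} x + A_{i2} x² + A_{i3} x³ + A_{i4} x⁴ + A_{i5} y + A_{i6} xy + A_{i7} x²y)`. -/
def IsEliminationMatrix (A : Matrix (Fin 7) (Fin 7) ParamRing) : Prop :=
  ∀ a : Fin 7 → ParamRing, ∃ (b : Fin 9 → ParamRing) (c : Fin 13 → ParamRing),
    combination a b c = ∑ i, C (a i) * ∑ j, C (A i j) * targetMonomial j

end E7Family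

end

/-! Put `g = f + z²`. For every parameter value the seven monomials `1, x, …, x⁴, y, xy` are
independent modulo `(∂ₓf, ∂_y f)`. Row `i` of `A` reduces `mᵢ g` modulo the two derivatives, where
`mᵢ` is the `i`-th of these monomials; the target is spanned by `x, …, x⁴, y, xy, x²y`, with no
constant term, because `g₂` vanishes at the origin. Independence of the target monomials modulo such
multiples makes `A` unique.

At a singular point other than the origin, the values of the target monomials form a kernel vector
of `A`, so `det A = 0`. Conversely, a left kernel vector of `A` gives a combination `G` of the `mᵢ`
with `G g ∈ (∂ₓf, ∂_y f)`. If the surface is smooth, the Nullstellensatz makes `g` invertible modulo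
this ideal, so `G` lies in it and `G = 0`. These two facts give (iv).

Explicit kernel vectors modulo `t₇`, and modulo `t₇²` when `s₃ = 0`, give the factor `t₇` in (i) and
the second one in (v). With `x, y` of weights 2, 3 everything is quasi-homogeneous: `det A` has
weight 56 and its cofactor weight 49 = 7·7, so `t₇⁷` is the only monomial of degree at least 7 in
`t₇`; this gives (ii).

For (iii), singular surfaces with a marked singular point `(x, xw, 0)` are parametrized by an affine
space, so one factor of any factorization of `δ` vanishes under the parametrization. On a line where
`δ` has seven distinct nonzero roots in `t₇`, that factor vanishes at all of them. It therefore has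
full degree in `t₇`, and the other factor is a unit. -/

noncomputable section

namespace E7Family

/-! ### The elimination matrix, cleared of denominators -/

section Matrix

variable {S : Type*} [CommRing S]

/-- Multiplication by `3x` on the span of `x, x², x³, x⁴, y, xy, x²y` modulo the multiples of
`∂ₓf` and `∂_y f`. -/
def xStep (p : Fin 7 → S) (e : Fin 7 → S) : Fin 7 → S :=
  ![-(4 * p 1 * p 6 + p 4 ^ 2) * e 3 - p 6 * e 6,
    3 * e 0 - (8 * p 1 * p 5 + 3 * p 2 * p 4) * e 3 - 2 * p 5 * e 6,
    3 * e 1 - (12 * p 1 * p 3 + 2 * p 2 ^ 2 + 4 * p 4) * e 3 - 3 * p 3 * e 6,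
    3 * e 2 - (16 * p 1 ^ 2 + 5 * p 2) * e 3 - 4 * p 1 * e 6,
    -(2 * p 0 * p 4 - 3 * p 6) * e 3,
    3 * e 4 - (4 * p 0 * p 2 + 4 * p 1 * p 4 - 6 * p 5) * e 3 - p 4 * e 6,
    3 * e 5 - (6 * p 0 + 8 * p 1 * p 2 - 9 * p 3) * e 3 - 2 * p 2 * e 6]

/-- The reduction of `9 f`. -/
def rowOne (p : Fin 7 → S) : Fin 7 → S :=
  ![-p 0 * p 4 + 7 * p 6, -p 0 * p 2 + 5 * p 5, -p 0 + 3 * p 3, p 1, -2 * p 0 ^ 2, 4 * p 4,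
    2 * p 2]

/-- The reduction of `81 y f`. -/
def rowY (p : Fin 7 → S) : Fin 7 → S :=
  ![6 * p 0 ^ 2 * p 4 + 3 * p 0 * p 6 + 16 * p 1 ^ 3 * p 6 + 4 * p 1 ^ 2 * p 4 ^ 2
      + 10 * p 1 * p 2 * p 6 + 2 * p 2 * p 4 ^ 2 - 9 * p 3 * p 6,
    6 * p 0 ^ 2 * p 2 + 6 * p 0 * p 5 + 32 * p 1 ^ 3 * p 5 + 12 * p 1 ^ 2 * p 2 * p 4
      + 20 * p 1 * p 2 * p 5 - 3 * p 1 * p 6 + 6 * p 2 ^ 2 * p 4 - 18 * p 3 * p 5 - 12 * p 4 ^ 2,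
    6 * p 0 ^ 2 + 9 * p 0 * p 3 + 48 * p 1 ^ 3 * p 3 + 8 * p 1 ^ 2 * p 2 ^ 2 + 16 * p 1 ^ 2 * p 4
      + 30 * p 1 * p 2 * p 3 - 6 * p 1 * p 5 + 4 * p 2 ^ 3 - 10 * p 2 * p 4 - 27 * p 3 ^ 2,
    12 * p 0 * p 1 + 64 * p 1 ^ 4 + 60 * p 1 ^ 2 * p 2 - 45 * p 1 * p 3 + 4 * p 2 ^ 2 - 12 * p 4,
    12 * p 0 ^ 3 + 8 * p 0 * p 1 ^ 2 * p 4 + 4 * p 0 * p 2 * p 4 - 12 * p 1 ^ 2 * p 6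
      - 6 * p 2 * p 6,
    16 * p 0 * p 1 ^ 2 * p 2 + 8 * p 0 * p 2 ^ 2 - 30 * p 0 * p 4 + 16 * p 1 ^ 3 * p 4
      - 24 * p 1 ^ 2 * p 5 + 10 * p 1 * p 2 * p 4 - 12 * p 2 * p 5 - 9 * p 3 * p 4 + 63 * p 6,
    24 * p 0 * p 1 ^ 2 - 3 * p 0 * p 2 + 32 * p 1 ^ 3 * p 2 - 36 * p 1 ^ 2 * p 3
      + 20 * p 1 * p 2 ^ 2 - 3 * p 1 * p 4 - 36 * p 2 * p 3 + 45 * p 5]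

/-- The elimination matrix, with row `i` multiplied by `rowScale i`. -/
def integralMatrix (p : Fin 7 → S) : Matrix (Fin 7) (Fin 7) S :=
  Matrix.of ![rowOne p, xStep p (rowOne p), xStep p (xStep p (rowOne p)),
    xStep p (xStep p (xStep p (rowOne p))), xStep p (xStep p (xStep p (xStep p (rowOne p)))),
    rowY p, xStep p (rowY p)]

/-- The common denominators of the rows of the elimination matrix. -/
def rowScale : Fin 7 → ℕ := ![9, 27, 81, 243, 729, 81, 243]

variable {T : Type*} [CommRing T]

theorem map_xStep (φ : S →+* T) (p e : Fin 7 → S) :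
    φ ∘ xStep p e = xStep (φ ∘ p) (φ ∘ e) := by
  ext i
  fin_cases i <;> simp [xStep, map_ofNat]

theorem map_rowOne (φ : S →+* T) (p : Fin 7 → S) : φ ∘ rowOne p = rowOne (φ ∘ p) := by
  ext i
  fin_cases i <;> simp [rowOne, map_ofNat]

theorem map_rowY (φ : S →+* T) (p : Fin 7 → S) : φ ∘ rowY p = rowY (φ ∘ p) := by
  ext i
  fin_cases i <;> simp [rowY, map_ofNat]

theorem map_integralMatrix (φ : S →+* T) (p : Fin 7 → S) :
    (integralMatrix p).map φ = integralMatrix (φ ∘ p) := by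
  have h : ∀ i, φ ∘ integralMatrix p i = integralMatrix (φ ∘ p) i := by
    simp only [integralMatrix, ← map_xStep, ← map_rowOne, ← map_rowY]
    intro i
    fin_cases i <;> rfl
  exact Matrix.ext fun i j => congrFun (h i) j

/-- A property of row vectors which holds for the reductions of `f` and `y f` and is preserved by
`xStep` holds for all rows. -/
theorem integralMatrix_row_induction {p : Fin 7 → S} {P : (Fin 7 → S) → Prop}
    (h₁ : P (rowOne p)) (hy : P (rowY p)) (hx : ∀ e, P e → P (xStep p e)) (i : Fin 7) :
    P (integralMatrix p i) := by
  fin_cases i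
  exacts [h₁, hx _ h₁, hx _ (hx _ h₁), hx _ (hx _ (hx _ h₁)), hx _ (hx _ (hx _ (hx _ h₁))), hy,
    hx _ hy]

end Matrix

/-! ### Reduction of multiples of `f + z²` modulo the two derivatives -/

section Reduction

variable {R : Type*} [CommRing R]

theorem pderiv_zero_familyPoly (p : Fin 7 → R) : pderiv 0 (familyPoly p) =
    (3 * X 0 ^ 2 + 2 * C (p 2) * X 0 + C (p 4)) * X 1
      + (4 * C (p 1) * X 0 ^ 3 + 3 * C (p 3) * X 0 ^ 2 + 2 * C (p 5) * X 0 + C (p 6)) := by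
  simp [familyPoly, pderiv_X]
  ring

theorem pderiv_one_familyPoly (p : Fin 7 → R) : pderiv 1 (familyPoly p) =
    3 * X 1 ^ 2 + 2 * C (p 0) * X 1 + (X 0 ^ 3 + C (p 2) * X 0 ^ 2 + C (p 4) * X 0) := by
  simp [familyPoly, pderiv_X]
  ring

theorem pderiv_two_familyPoly (p : Fin 7 → R) : pderiv 2 (familyPoly p) = -2 * X 2 := by
  simp [familyPoly, pderiv_X]

/-- The multiple `m (f + z²)` is congruent to the combination of the target monomials with
coefficients `e`, by multipliers `g₂` and `g₃` with coefficients `b` and `c`. -/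
def Reduces (m : MvPolynomial (Fin 3) ParamRing) (b : Fin 9 → ParamRing) (c : Fin 13 → ParamRing)
    (e : Fin 7 → ParamRing) : Prop :=
  m * (genericPoly + X 2 ^ 2) + ansatz₂ b * pderiv 0 genericPoly
    + ansatz₃ c * pderiv 1 genericPoly = ∑ j, C (e j) * targetMonomial j

/-- The multiplier of `∂ₓf` in the reduction of `3x m (f + z²)`. -/
def xStepMultiplierX (b : Fin 9 → ParamRing) (e : Fin 7 → ParamRing) : Fin 9 → ParamRing :=
  ![-3 * X 4 * b 1 - 4 * X 1 * e 3 - e 6, 3 * b 0 - 3 * X 2 * b 1, -6 * X 0 * b 1 + 3 * e 3,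
    3 * b 2, 3 * b 3, 3 * b 4, -9 * b 1, 3 * b 6, 3 * b 7]

/-- The multiplier of `∂_y f` in the reduction of `3x m (f + z²)`. -/
def xStepMultiplierY (b : Fin 9 → ParamRing) (c : Fin 13 → ParamRing) (e : Fin 7 → ParamRing) :
    Fin 13 → ParamRing :=
  ![-X 4 * e 3 + 3 * b 1 * X 6, 3 * c 0 - 2 * X 2 * e 3 + 6 * b 1 * X 5,
    3 * c 1 - 3 * e 3 + 9 * b 1 * X 3, 3 * c 2 + 12 * b 1 * X 1, 3 * c 3, 3 * c 4,
    3 * b 1 * X 4, 3 * c 6 + 6 * b 1 * X 2, 3 * c 7 + 9 * b 1, 3 * c 8, 3 * c 9, 0, 3 * c 11]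

/-- Multiplication by `3x` creates three kinds of unwanted terms. The term `x³y` is removed by
`-e₃₊₃ x ∂ₓf`, with `e₃₊₃ = e 6`. The term `x⁵` is removed by `x² ∂_y f`, whose `x²y²` is cancelled
by `y ∂ₓf`. The term `x³` in `g₂` is traded away by the Koszul relation between `∂ₓf` and `∂_y f`.
The vanishing top coefficients keep the other products within the ansatz. -/
theorem Reduces.xStep {m : MvPolynomial (Fin 3) ParamRing} {b : Fin 9 → ParamRing}
    {c : Fin 13 → ParamRing} {e : Fin 7 → ParamRing} (h : Reduces m b c e)
    (hb₅ : b 5 = 0) (hb₈ : b 8 = 0) (hc₅ : c 5 = 0) (hc₁₀ : c 10 = 0) (hc₁₂ : c 12 = 0) :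
    Reduces (3 * X 0 * m) (xStepMultiplierX b e) (xStepMultiplierY b c e) (xStep X e) := by
  simp only [Reduces, ansatz₂, ansatz₃, genericPoly, pderiv_zero_familyPoly,
    pderiv_one_familyPoly, targetMonomial, Fin.sum_univ_succ, Fin.sum_univ_zero,
    Matrix.cons_val_zero, Matrix.cons_val_succ, hb₅, hb₈, hc₅, hc₁₀, hc₁₂, C_0] at h ⊢
  simp only [E7Family.xStep, xStepMultiplierX, xStepMultiplierY, Matrix.cons_val, Fin.isValue,
    Fin.succ_zero_eq_one, Fin.succ_one_eq_two, Fin.reduceSucc, C_add, C_sub, C_mul, C_neg, C_pow,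
    map_ofNat, C_0] at h ⊢
  linear_combination 3 * X 0 * h

/-- This is Euler's relation for the weights 2, 3 of `x, y`: `9g - 2x ∂ₓg - 3y ∂_y g` is the sum of
the weighted parameter terms. Its only term off the target is `3s₃y²`, which `-s₃ ∂_y g` removes. -/
theorem reduces_rowOne : Reduces 9 ![-2, 0, 0, 0, 0, 0, 0, 0, 0]
    ![-X 0, 0, 0, 0, 0, 0, -3, 0, 0, 0, 0, 0, 0] (rowOne X) := by
  simp only [Reduces, ansatz₂, ansatz₃, genericPoly, pderiv_zero_familyPoly,
    pderiv_one_familyPoly, targetMonomial, Fin.sum_univ_succ, Fin.sum_univ_zero]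
  simp only [familyPoly, Matrix.cons_val_zero, Matrix.cons_val_succ, rowOne, Matrix.cons_val,
    Fin.isValue, C_add, C_mul, C_neg, C_pow, map_ofNat, C_0]
  ring

/-- The multipliers `-18xy`, `-27y²` and `-9s₃y` are `9y` times those of `reduces_rowOne`; the
others clear the resulting `x³y, x⁴y, y², xy², x²y²`. -/
theorem reduces_rowY : Reduces (81 * X 1)
    ![3 * X 0 + 16 * X 1 ^ 3 + 10 * X 1 * X 2 - 9 * X 3, -3 * X 1, -12 * X 1 ^ 2 - 6 * X 2, -18,
      0, 0, 0, 0, 0]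
    ![6 * X 0 ^ 2 + 4 * X 1 ^ 2 * X 4 + 2 * X 2 * X 4,
      8 * X 1 ^ 2 * X 2 + 4 * X 2 ^ 2 - 12 * X 4, 12 * X 1 ^ 2, 0, 0, 0, -9 * X 0, 0, 0, 0, 0,
      -27, 0] (rowY X) := by
  simp only [Reduces, ansatz₂, ansatz₃, genericPoly, pderiv_zero_familyPoly,
    pderiv_one_familyPoly, targetMonomial, Fin.sum_univ_succ, Fin.sum_univ_zero]
  simp only [familyPoly, Matrix.cons_val_zero, Matrix.cons_val_succ, rowY, Matrix.cons_val,
    Fin.isValue, C_add, C_sub, C_mul, C_neg, C_pow, map_ofNat, C_0]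
  ring

theorem Reduces.of_eq {m m' : MvPolynomial (Fin 3) ParamRing} {b : Fin 9 → ParamRing}
    {c : Fin 13 → ParamRing} {e : Fin 7 → ParamRing} (h : Reduces m b c e) (hm : m = m') :
    Reduces m' b c e :=
  hm ▸ h

/-- The monomials `1, x, x², x³, x⁴, y, xy`. -/
def sourceMonomial : Fin 7 → MvPolynomial (Fin 3) ParamRing :=
  ![1, X 0, X 0 ^ 2, X 0 ^ 3, X 0 ^ 4, X 1, X 0 * X 1]

theorem exists_reduces (i : Fin 7) :
    ∃ b c, Reduces (rowScale i * sourceMonomial i) b c (integralMatrix X i) := by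
  have h₀ := reduces_rowOne
  have h₁ := h₀.xStep rfl rfl rfl rfl rfl
  have h₂ := h₁.xStep (by simp [xStepMultiplierX]) (by simp [xStepMultiplierX])
    (by simp [xStepMultiplierY]) (by simp [xStepMultiplierY]) (by simp [xStepMultiplierY])
  have h₃ := h₂.xStep (by simp [xStepMultiplierX]) (by simp [xStepMultiplierX])
    (by simp [xStepMultiplierY]) (by simp [xStepMultiplierY]) (by simp [xStepMultiplierY])
  have h₄ := h₃.xStep (by simp [xStepMultiplierX]) (by simp [xStepMultiplierX])
    (by simp [xStepMultiplierY]) (by simp [xStepMultiplierY]) (by simp [xStepMultiplierY])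
  have h₅ := reduces_rowY
  have h₆ := h₅.xStep rfl rfl rfl rfl rfl
  fin_cases i
  · exact ⟨_, _, h₀.of_eq (by simp [rowScale, sourceMonomial])⟩
  · exact ⟨_, _, h₁.of_eq (by simp [rowScale, sourceMonomial]; ring)⟩
  · exact ⟨_, _, h₂.of_eq (by simp [rowScale, sourceMonomial]; ring)⟩
  · exact ⟨_, _, h₃.of_eq (by simp [rowScale, sourceMonomial]; ring)⟩
  · exact ⟨_, _, h₄.of_eq (by simp [rowScale, sourceMonomial]; ring)⟩
  · exact ⟨_, _, h₅.of_eq (by simp [rowScale, sourceMonomial])⟩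
  · exact ⟨_, _, h₆.of_eq (by simp [rowScale, sourceMonomial]; ring)⟩

end Reduction

/-! ### Existence of the elimination matrix -/

section Existence

theorem rowScale_ne_zero (i : Fin 7) : (rowScale i : ℂ) ≠ 0 := by
  fin_cases i <;> simp [rowScale]

/-- The elimination matrix. -/
def elimMatrix : Matrix (Fin 7) (Fin 7) ParamRing :=
  Matrix.of fun i j => C (rowScale i : ℂ)⁻¹ * integralMatrix X i j

theorem det_elimMatrix :
    elimMatrix.det = C (∏ i, (rowScale i : ℂ)⁻¹) * (integralMatrix X : Matrix _ _ ParamRing).det := by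
  rw [map_prod, ← Matrix.det_mul_column]
  rfl

theorem combination_eq (a : Fin 7 → ParamRing) (b : Fin 9 → ParamRing)
    (c : Fin 13 → ParamRing) :
    combination a b c = (∑ i, C (a i) * sourceMonomial i) * (genericPoly + X 2 ^ 2)
      + ansatz₂ b * pderiv 0 genericPoly + ansatz₃ c * pderiv 1 genericPoly := by
  have hz : (1 / 2 : ℂ) • (X 2 * ansatz₁ a * pderiv 2 genericPoly) = -ansatz₁ a * X 2 ^ 2 := by
    have h2 : X 2 * ansatz₁ a * (-2 * X 2) = (2 : ℂ) • (-ansatz₁ a * X 2 ^ 2) := by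
      rw [ofNat_smul_eq_nsmul, nsmul_eq_mul]
      push_cast
      ring
    rw [genericPoly, pderiv_two_familyPoly, h2, smul_smul]
    norm_num
  have hs : ∑ i, C (a i) * sourceMonomial i = ansatz₁ a := by
    simp only [Fin.sum_univ_succ, sourceMonomial, ansatz₁]
    simp
    ring
  rw [combination, hz, hs]
  ring

theorem ansatz₂_sum (k : Fin 7 → ParamRing) (b : Fin 7 → Fin 9 → ParamRing) :
    ansatz₂ (∑ i, k i • b i) = ∑ i, C (k i) * ansatz₂ (b i) := by
  simp only [ansatz₂, Finset.sum_apply, Pi.smul_apply, smul_eq_mul, map_sum, C_mul,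
    Finset.sum_mul, ← Finset.sum_add_distrib]
  exact Finset.sum_congr rfl fun i _ => by ring

theorem ansatz₃_sum (k : Fin 7 → ParamRing) (c : Fin 7 → Fin 13 → ParamRing) :
    ansatz₃ (∑ i, k i • c i) = ∑ i, C (k i) * ansatz₃ (c i) := by
  simp only [ansatz₃, Finset.sum_apply, Pi.smul_apply, smul_eq_mul, map_sum, C_mul,
    Finset.sum_mul, ← Finset.sum_add_distrib]
  exact Finset.sum_congr rfl fun i _ => by ring

theorem isEliminationMatrix_elimMatrix : IsEliminationMatrix elimMatrix := by
  intro a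
  choose b c h using exists_reduces
  set k : Fin 7 → ParamRing := fun i => a i * C (rowScale i : ℂ)⁻¹ with hk
  refine ⟨∑ i, k i • b i, ∑ i, k i • c i, ?_⟩
  rw [combination_eq, ansatz₂_sum, ansatz₃_sum]
  simp only [Finset.sum_mul, ← Finset.sum_add_distrib]
  refine Finset.sum_congr rfl fun i _ => ?_
  have hi : C (a i) = C (k i) * (rowScale i : MvPolynomial (Fin 3) ParamRing) := by
    have h1 : a i = k i * (rowScale i : ParamRing) := by
      have : (C (rowScale i : ℂ)⁻¹ : ParamRing) * (rowScale i : ParamRing) = 1 := by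
        rw [← map_natCast (C : ℂ →+* ParamRing), ← C_mul, inv_mul_cancel₀ (rowScale_ne_zero i), C_1]
      rw [hk, mul_assoc, this, mul_one]
    conv_lhs => rw [h1]
    rw [C_mul, map_natCast]
  have he : C (a i) * ∑ j, C (elimMatrix i j) * targetMonomial j
      = C (k i) * ∑ j, C (integralMatrix X i j) * targetMonomial j := by
    rw [Finset.mul_sum, Finset.mul_sum]
    refine Finset.sum_congr rfl fun j _ => ?_
    rw [elimMatrix, Matrix.of_apply, hk, C_mul, C_mul]
    ring
  rw [he, ← h i, hi]
  ring

end Existence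

/-! ### Singular points give kernel vectors -/

section Vanishing

variable {P : Type*} [CommRing P] [IsDomain P]

/-- If the curve `f(x, y, 0) = 0` has a singular point different from the origin, then the
determinant of the elimination matrix vanishes. -/
theorem map_det_integralMatrix_eq_zero (φ : ParamRing →+* P) (v : Fin 3 → P)
    (hg : eval₂ φ v (genericPoly + X 2 ^ 2) = 0) (hx : eval₂ φ v (pderiv 0 genericPoly) = 0)
    (hy : eval₂ φ v (pderiv 1 genericPoly) = 0) (hv : v 0 ≠ 0 ∨ v 1 ≠ 0) :
    φ (integralMatrix X).det = 0 := by
  rw [RingHom.map_det, ← Matrix.exists_mulVec_eq_zero_iff]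
  -- The kernel vector consists of the values of the target monomials; it is nonzero because `x` and
  -- `y` are among them.
  refine ⟨fun j => eval₂ φ v (targetMonomial j), fun h => ?_, ?_⟩
  · have h0 := congrFun h 0
    have h4 := congrFun h 4
    simp [targetMonomial] at h0 h4
    tauto
  · ext i
    obtain ⟨b, c, h⟩ := exists_reduces i
    have := congrArg (eval₂ φ v) h
    simp only [eval₂_add, eval₂_mul, eval₂_sum, eval₂_C] at this
    rw [← eval₂_add, hg, hx, hy] at this
    simpa [Matrix.mulVec, dotProduct] using this.symm

end Vanishing

/-! ### Divisibility of the determinant by powers of `t₇` -/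

section Divisibility

variable {S : Type*} [CommRing S]

/-- Multiplying `M w` by the adjugate gives `det M • w`. -/
theorem dvd_mul_det_of_dvd_mulVec {n : Type*} [Fintype n] [DecidableEq n] (M : Matrix n n S)
    (w : n → S) (t : S) (h : ∀ i, t ∣ (M.mulVec w) i) (k : n) : t ∣ w k * M.det := by
  have h1 : M.adjugate.mulVec (M.mulVec w) = M.det • w := by
    rw [Matrix.mulVec_mulVec, Matrix.adjugate_mul, Matrix.smul_mulVec, Matrix.one_mulVec]
  have h2 := congrFun h1 k
  rw [Pi.smul_apply, smul_eq_mul, mul_comm] at h2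
  rw [← h2]
  exact Finset.dvd_sum fun i _ => Dvd.dvd.mul_left (h i) _

/-- If `t₇ = 0`, the origin is singular. Differentiation at the origin along `(2s₃, -t₄)`, which
annihilates the linear part of `∂_y f`, kills every row: the products with `f` and with `∂ₓf` vanish
there to second order. -/
theorem dvd_two_mul_det_integralMatrix (p : Fin 7 → S) :
    p 6 ∣ 2 * p 0 * (integralMatrix p).det := by
  refine dvd_mul_det_of_dvd_mulVec _ ![2 * p 0, 0, 0, 0, -p 4, 0, 0] _ (fun i => ?_) 0
  have : p 6 ∣ 2 * p 0 * integralMatrix p i 0 - p 4 * integralMatrix p i 4 := by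
    refine integralMatrix_row_induction (P := fun e => p 6 ∣ 2 * p 0 * e 0 - p 4 * e 4)
      ?_ ?_ (fun e _ => ?_) i
    · refine ⟨14 * p 0, ?_⟩
      simp [rowOne]
      ring
    · refine ⟨6 * p 0 ^ 2 + 32 * p 0 * p 1 ^ 3 + 20 * p 0 * p 1 * p 2 - 18 * p 0 * p 3
        + 12 * p 1 ^ 2 * p 4 + 6 * p 2 * p 4, ?_⟩
      simp [rowY]
      ring
    · refine ⟨-8 * p 0 * p 1 * e 3 - 2 * p 0 * e 6 - 3 * p 4 * e 3, ?_⟩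
      simp [xStep]
      ring
  convert this using 1
  simp [Matrix.mulVec, dotProduct, Fin.sum_univ_succ]
  ring

/-- For `s₃ = 0` and `t₄ ≠ 0`, small `t₇` gives a critical point `y ≈ -t₇/t₄`, `x ≈ -3t₇²/t₄³` of
`f` in the plane `z = 0`, with `f = O(t₇³)`. The vector used is the leading part of the target
monomials there, rescaled by `-t₄³/t₇`. -/
theorem sq_dvd_mul_det_integralMatrix (p : Fin 7 → S) (h0 : p 0 = 0) :
    p 6 ^ 2 ∣ p 4 ^ 2 * (integralMatrix p).det := by
  refine dvd_mul_det_of_dvd_mulVec _ ![3 * p 6, 0, 0, 0, p 4 ^ 2, 0, 0] _ (fun i => ?_) 4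
  have : p 6 ^ 2 ∣ 3 * p 6 * integralMatrix p i 0 + p 4 ^ 2 * integralMatrix p i 4 := by
    refine integralMatrix_row_induction
      (P := fun e => p 6 ^ 2 ∣ 3 * p 6 * e 0 + p 4 ^ 2 * e 4) ?_ ?_ (fun e _ => ?_) i
    · refine ⟨21, ?_⟩
      simp [rowOne, h0]
      ring
    · refine ⟨48 * p 1 ^ 3 + 30 * p 1 * p 2 - 27 * p 3, ?_⟩
      simp [rowY, h0]
      ring
    · refine ⟨-12 * p 1 * e 3 - 3 * e 6, ?_⟩
      simp [xStep, h0]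
      ring
  convert this using 1
  simp [Matrix.mulVec, dotProduct, Fin.sum_univ_succ]
  ring

end Divisibility

/-! ### Independence modulo the derivatives, by degrees in `x` -/

section Independence

open Polynomial (natDegree)

variable {S : Type*} [CommRing S]

/-- The coefficient of `y` in `∂ₓf`. -/
def slopeX (p : Fin 7 → S) : Polynomial S :=
  .C 3 * .X ^ 2 + .C (2 * p 2) * .X + .C (p 4)

/-- The part of `∂ₓf` without `y`. -/
def constX (p : Fin 7 → S) : Polynomial S :=
  .C (4 * p 1) * .X ^ 3 + .C (3 * p 3) * .X ^ 2 + .C (2 * p 5) * .X + .C (p 6)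

/-- The part of `∂_y f` without `y`. -/
def constY (p : Fin 7 → S) : Polynomial S :=
  .C 1 * .X ^ 3 + .C (p 2) * .X ^ 2 + .C (p 4) * .X + .C 0

/-- `∂ₓf` as a polynomial in `y` over the polynomials in `x`. -/
def curveX (p : Fin 7 → S) : Polynomial (Polynomial S) := .C (slopeX p) * .X + .C (constX p)

/-- `∂_y f` as a polynomial in `y` over the polynomials in `x`. -/
def curveY (p : Fin 7 → S) : Polynomial (Polynomial S) :=
  .C (.C 3) * .X ^ 2 + .C (.C (2 * p 0)) * .X + .C (constY p)

variable [IsDomain S]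

/-- The hypotheses are the two `y`-coefficients of `(u₀ + u₁y) ∂ₓf` reduced modulo `∂_y f`. If `u₁ ≠
0`, one of them has a dominant term of too large degree. If `u₁ = 0`, then `u₀` is constant, and
`hu` excludes a nonzero constant. -/
theorem eq_zero_of_mul_slopeX_eq (p : Fin 7 → S) {r : S} (hr : r * 3 = 1)
    {u₀ u₁ M₀ M₁ : Polynomial S} (h₀ : natDegree M₀ ≤ 4) (h₁ : natDegree M₁ ≤ 2)
    (hu : natDegree M₁ ≤ 1 ∨ u₀.coeff 0 = 0)
    (e₁ : u₀ * slopeX p + u₁ * (constX p - .C (r * (2 * p 0)) * slopeX p) = M₁)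
    (e₀ : u₀ * constX p - .C r * constY p * u₁ * slopeX p = M₀) :
    u₀ = 0 ∧ u₁ = 0 := by
  have h3 : (3 : S) ≠ 0 := right_ne_zero_of_mul_eq_one hr
  have hr0 : r ≠ 0 := left_ne_zero_of_mul_eq_one hr
  have dα : natDegree (slopeX p) = 2 := Polynomial.natDegree_quadratic h3
  have dκ : natDegree (constY p) = 3 := Polynomial.natDegree_cubic one_ne_zero
  have dβ : natDegree (constX p) ≤ 3 := Polynomial.natDegree_cubic_le
  have hα : slopeX p ≠ 0 := fun h => by simp [h] at dα
  have hκ : constY p ≠ 0 := fun h => by simp [h] at dκ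
  have dβ' : natDegree (constX p - .C (r * (2 * p 0)) * slopeX p) ≤ 3 := by
    refine (Polynomial.natDegree_sub_le _ _).trans (max_le dβ ?_)
    exact (Polynomial.natDegree_C_mul_le _ _).trans (by omega)
  have hu1 : u₁ = 0 := by
    by_contra hne
    have d1 : natDegree (.C r * constY p * u₁ * slopeX p) = natDegree u₁ + 5 := by
      have hC : (Polynomial.C r) ≠ 0 := by simpa using hr0
      rw [Polynomial.natDegree_mul (by positivity) hα, Polynomial.natDegree_mul (by positivity) hne,
        Polynomial.natDegree_mul hC hκ, Polynomial.natDegree_C, dα, dκ]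
      ring
    -- In the first case `constY * u₁ * slopeX` dominates and `M₀` has degree at least 5; in the
    -- second `u₀ * slopeX` dominates and `M₁` has degree at least 4.
    by_cases hd : natDegree u₀ ≤ natDegree u₁ + 1
    · have d2 : natDegree (u₀ * constX p) < natDegree (.C r * constY p * u₁ * slopeX p) := by
        have := Polynomial.natDegree_mul_le (p := u₀) (q := constX p)
        omega
      have := Polynomial.natDegree_sub_eq_right_of_natDegree_lt d2
      rw [e₀] at this
      omega
    · have hu0 : u₀ ≠ 0 := fun h => by simp [h] at hd
      have d2 : natDegree (u₁ * (constX p - .C (r * (2 * p 0)) * slopeX p))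
          < natDegree (u₀ * slopeX p) := by
        have := Polynomial.natDegree_mul_le (p := u₁)
          (q := constX p - .C (r * (2 * p 0)) * slopeX p)
        rw [Polynomial.natDegree_mul hu0 hα]
        omega
      have := Polynomial.natDegree_add_eq_left_of_natDegree_lt d2
      rw [e₁, Polynomial.natDegree_mul hu0 hα] at this
      omega
  refine ⟨?_, hu1⟩
  by_contra hne
  rw [hu1, zero_mul, add_zero] at e₁
  have d2 := Polynomial.natDegree_mul hne hα
  rw [e₁, dα] at d2
  have hd : natDegree u₀ = 0 := by omega
  rcases hu with hu | hu
  · omega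
  · rw [Polynomial.eq_C_of_natDegree_eq_zero hd, hu, Polynomial.C_0] at hne
    exact hne rfl

/-- Reduction of a combination of a linear polynomial and a monic quadratic polynomial modulo the
latter. -/
theorem exists_reduction_mod_quadratic {B : Type*} [CommRing B] [Nontrivial B] (α β a b M₀ M₁ : B)
    (u v : Polynomial B)
    (h : u * (.C α * .X + .C β) + v * (.X ^ 2 + (.C a * .X + .C b)) = .C M₁ * .X + .C M₀) :
    ∃ u₀ u₁ q : B, u₀ * α + u₁ * (β - a * α) = M₁ ∧ u₀ * β - b * u₁ * α = M₀ ∧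
      u.coeff 0 = u₀ + b * q := by
  set G : Polynomial B := .X ^ 2 + (.C a * .X + .C b) with hG
  have hlow : ∀ a b : B,
      (Polynomial.C a * Polynomial.X + Polynomial.C b).degree < ((2 : ℕ) : WithBot ℕ) :=
    fun a b => Polynomial.degree_linear_lt
  have hGm : G.Monic := Polynomial.monic_X_pow_add (hlow _ _)
  have hGd : G.degree = ((2 : ℕ) : WithBot ℕ) := by
    rw [hG, Polynomial.degree_add_eq_left_of_degree_lt, Polynomial.degree_X_pow]
    rw [Polynomial.degree_X_pow]
    exact hlow _ _
  obtain ⟨R, Q, hdiv, hRd⟩ : ∃ R Q, R + G * Q = u ∧ R.degree < ((2 : ℕ) : WithBot ℕ) :=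
    ⟨u %ₘ G, u /ₘ G, Polynomial.modByMonic_add_div u G,
      hGd ▸ Polynomial.degree_modByMonic_lt u hGm⟩
  obtain ⟨u₀, u₁, rfl⟩ : ∃ u₀ u₁, R = .C u₁ * .X + .C u₀ :=
    ⟨_, _, Polynomial.eq_X_add_C_of_degree_le_one (Order.le_of_lt_succ hRd)⟩
  -- The reduced product minus the right-hand side is linear in `y` and a multiple of the monic
  -- quadratic `G`, hence zero.
  have key : (.C (u₀ * α + u₁ * (β - a * α) - M₁) * .X + .C (u₀ * β - b * u₁ * α - M₀) :
      Polynomial B) = G * (-Q * (.C α * .X + .C β) - v - .C (u₁ * α)) := by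
    rw [← hdiv] at h
    simp only [Polynomial.C_sub, Polynomial.C_add, Polynomial.C_mul]
    linear_combination h - (Polynomial.C u₁ * Polynomial.C α) * hG
  have hz : (.C (u₀ * α + u₁ * (β - a * α) - M₁) * .X + .C (u₀ * β - b * u₁ * α - M₀) :
      Polynomial B) = 0 := by
    by_contra hne
    exact hGm.not_dvd_of_degree_lt hne (hGd ▸ hlow _ _) ⟨_, key⟩
  have e₁ := congrArg (fun q => Polynomial.coeff q 1) hz
  have e₀ := congrArg (fun q => Polynomial.coeff q 0) hz
  simp only [Polynomial.coeff_add, Polynomial.coeff_C_mul, Polynomial.coeff_X_one,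
    Polynomial.coeff_X_zero, Polynomial.coeff_C_zero, Polynomial.coeff_C_succ,
    Polynomial.coeff_zero, mul_one, mul_zero, add_zero, zero_add] at e₀ e₁
  refine ⟨u₀, u₁, Q.coeff 0, sub_eq_zero.1 e₁, sub_eq_zero.1 e₀, ?_⟩
  rw [← hdiv, hG]
  simp [Polynomial.mul_coeff_zero]

/-- The monomials `1, x, …, x⁴, y, xy` are independent modulo the ideal `(∂ₓf, ∂_y f)`, and the
monomials `x, …, x⁴, y, xy, x²y` are independent modulo `(x, y) ∂ₓf + (∂_y f)`. -/
theorem eq_zero_of_eq_combination (p : Fin 7 → S) (h3 : IsUnit (3 : S))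
    {u v : Polynomial (Polynomial S)} {M₀ M₁ : Polynomial S}
    (h₀ : natDegree M₀ ≤ 4) (h₁ : natDegree M₁ ≤ 2)
    (hu : natDegree M₁ ≤ 1 ∨ (u.coeff 0).coeff 0 = 0)
    (h : u * curveX p + v * curveY p = .C M₁ * .X + .C M₀) : M₀ = 0 ∧ M₁ = 0 := by
  obtain ⟨r, hr⟩ := h3.exists_left_inv
  have hCr : (Polynomial.C (Polynomial.C r) * Polynomial.C (Polynomial.C 3) :
      Polynomial (Polynomial S)) = 1 := by
    rw [← Polynomial.C_mul, ← Polynomial.C_mul, hr, Polynomial.C_1, Polynomial.C_1]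
  have hGy : curveY p = .C (.C 3) *
      (.X ^ 2 + (.C (.C (r * (2 * p 0))) * .X + .C (.C r * constY p))) := by
    simp only [curveY, Polynomial.C_mul]
    linear_combination (-(Polynomial.C (Polynomial.C (2 : S))) *
      Polynomial.C (Polynomial.C (p 0)) * Polynomial.X - Polynomial.C (constY p)) * hCr
  rw [hGy, ← mul_assoc] at h
  obtain ⟨u₀, u₁, q, e₁, e₀, eu⟩ := exists_reduction_mod_quadratic _ _ _ _ _ _ _ _ h
  -- Reducing `u` changes its `y⁰`-coefficient by a multiple of `constY p`, which vanishes at `x =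
  -- 0`.
  have hu' : natDegree M₁ ≤ 1 ∨ u₀.coeff 0 = 0 := by
    refine hu.imp_right fun hc => ?_
    rw [eu] at hc
    simpa [constY, Polynomial.mul_coeff_zero] using hc
  obtain ⟨z₀, z₁⟩ := eq_zero_of_mul_slopeX_eq p hr h₀ h₁ hu' e₁ e₀
  rw [z₀, z₁] at e₀ e₁
  constructor
  · rw [← e₀]; ring
  · rw [← e₁]; ring

end Independence

/-! ### Passage to polynomials in `y` over polynomials in `x` -/

section Bivariate

variable {R S : Type*} [CommRing R] [CommRing S]

/-- Restriction of a polynomial in `x, y, z` to `z = 0`, as a polynomial in `y` over the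
polynomials in `x`, after a change of coefficients. -/
def restrict (φ : R →+* S) : MvPolynomial (Fin 3) R →+* Polynomial (Polynomial S) :=
  eval₂Hom ((Polynomial.C.comp Polynomial.C).comp φ) ![.C .X, .X, 0]

theorem restrict_C (φ : R →+* S) (r : R) : restrict φ (C r) = .C (.C (φ r)) := by
  simp [restrict]

theorem restrict_X_zero (φ : R →+* S) : restrict φ (X 0) = .C .X := by simp [restrict]

theorem restrict_X_one (φ : R →+* S) : restrict φ (X 1) = .X := by simp [restrict]

theorem restrict_X_two (φ : R →+* S) : restrict φ (X 2) = 0 := by simp [restrict]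

theorem restrict_pderiv_zero (φ : R →+* S) (p : Fin 7 → R) :
    restrict φ (pderiv 0 (familyPoly p)) = curveX (φ ∘ p) := by
  rw [pderiv_zero_familyPoly]
  simp only [map_add, map_mul, map_pow, map_ofNat, restrict_C, restrict_X_zero, restrict_X_one,
    curveX, slopeX, constX, Function.comp_apply]

theorem restrict_pderiv_one (φ : R →+* S) (p : Fin 7 → R) :
    restrict φ (pderiv 1 (familyPoly p)) = curveY (φ ∘ p) := by
  rw [pderiv_one_familyPoly]
  simp only [map_add, map_mul, map_pow, map_ofNat, restrict_C, restrict_X_zero, restrict_X_one,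
    curveY, constY, Function.comp_apply, map_zero, map_one]
  ring

theorem restrict_sum_target (φ : ParamRing →+* S) (e : Fin 7 → ParamRing) :
    restrict φ (∑ j, C (e j) * targetMonomial j)
      = .C (.C (φ (e 4)) + .C (φ (e 5)) * .X + .C (φ (e 6)) * .X ^ 2) * .X
        + .C (.C (φ (e 0)) * .X + .C (φ (e 1)) * .X ^ 2 + .C (φ (e 2)) * .X ^ 3
          + .C (φ (e 3)) * .X ^ 4) := by
  simp only [targetMonomial, Fin.sum_univ_succ, Fin.sum_univ_zero, Matrix.cons_val_zero,
    Matrix.cons_val_succ, map_add, map_mul, map_pow, restrict_C, restrict_X_zero, restrict_X_one,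
    map_zero]
  simp only [Fin.isValue, Fin.succ_zero_eq_one, Fin.succ_one_eq_two, Fin.reduceSucc]
  ring

theorem restrict_sum_source (φ : ParamRing →+* S) (e : Fin 7 → ParamRing) :
    restrict φ (∑ j, C (e j) * sourceMonomial j)
      = .C (.C (φ (e 5)) + .C (φ (e 6)) * .X) * .X
        + .C (.C (φ (e 0)) + .C (φ (e 1)) * .X + .C (φ (e 2)) * .X ^ 2 + .C (φ (e 3)) * .X ^ 3
          + .C (φ (e 4)) * .X ^ 4) := by
  simp only [sourceMonomial, Fin.sum_univ_succ, Fin.sum_univ_zero, Matrix.cons_val_zero,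
    Matrix.cons_val_succ, map_add, map_mul, map_pow, restrict_C, restrict_X_zero, restrict_X_one,
    map_zero, map_one]
  simp only [Fin.isValue, Fin.succ_zero_eq_one, Fin.succ_one_eq_two, Fin.reduceSucc]
  ring

theorem coeffs_eq_zero_of_quartic_eq_zero {a b c d e : S}
    (h : (.C a + .C b * .X + .C c * .X ^ 2 + .C d * .X ^ 3 + .C e * .X ^ 4 : Polynomial S) = 0) :
    a = 0 ∧ b = 0 ∧ c = 0 ∧ d = 0 ∧ e = 0 := by
  have hn : ∀ n, (.C a + .C b * .X + .C c * .X ^ 2 + .C d * .X ^ 3 + .C e * .X ^ 4 :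
      Polynomial S).coeff n = 0 := fun n => by rw [h, Polynomial.coeff_zero]
  simp only [Polynomial.coeff_add, Polynomial.coeff_C_mul, Polynomial.coeff_X_pow,
    Polynomial.coeff_X, Polynomial.coeff_C] at hn
  exact ⟨by simpa using hn 0, by simpa using hn 1, by simpa using hn 2, by simpa using hn 3,
    by simpa using hn 4⟩

theorem coeffs_eq_zero_of_quadratic_eq_zero {a b c : S}
    (h : (.C a + .C b * .X + .C c * .X ^ 2 : Polynomial S) = 0) : a = 0 ∧ b = 0 ∧ c = 0 := by
  obtain ⟨ha, hb, hc, -, -⟩ :=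
    coeffs_eq_zero_of_quartic_eq_zero (a := a) (b := b) (c := c) (d := 0) (e := 0) (by simpa using h)
  exact ⟨ha, hb, hc⟩

/-- This supplies the second alternative of `hu` in `eq_zero_of_eq_combination`, which is what
allows the monomial `x²y`. -/
theorem coeff_restrict_ansatz₂ (φ : ParamRing →+* S) (b : Fin 9 → ParamRing) :
    ((restrict φ (ansatz₂ b)).coeff 0).coeff 0 = 0 := by
  simp [ansatz₂, restrict_C, restrict_X_zero, restrict_X_one, Polynomial.mul_coeff_zero,
    pow_two]

end Bivariate

/-! ### Uniqueness of the elimination matrix -/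

section Uniqueness

theorem isUnit_three : IsUnit (3 : ParamRing) := by
  have h : IsUnit (C (3 : ℂ) : ParamRing) := (IsUnit.mk0 3 three_ne_zero).map C
  rwa [map_ofNat] at h

theorem IsEliminationMatrix.unique {A A' : Matrix (Fin 7) (Fin 7) ParamRing}
    (hA : IsEliminationMatrix A) (hA' : IsEliminationMatrix A') : A = A' := by
  have hd : ∀ i j, A i j - A' i j = 0 := by
    intro i
    obtain ⟨b, c, h⟩ := hA (Pi.single i 1)
    obtain ⟨b', c', h'⟩ := hA' (Pi.single i 1)
    have hs : ∀ M : Matrix (Fin 7) (Fin 7) ParamRing,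
        ∑ k, C ((Pi.single i 1 : Fin 7 → ParamRing) k) * ∑ j, C (M k j) * targetMonomial j
          = ∑ j, C (M i j) * targetMonomial j := by
      intro M
      rw [Finset.sum_eq_single i (fun k _ hk => by simp [hk]) (by simp)]
      simp
    rw [combination_eq, hs] at h h'
    have key : (ansatz₂ b - ansatz₂ b') * pderiv 0 genericPoly
        + (ansatz₃ c - ansatz₃ c') * pderiv 1 genericPoly
        = ∑ j, C ((A i - A' i) j) * targetMonomial j := by
      simp only [Pi.sub_apply, C_sub, sub_mul, Finset.sum_sub_distrib]
      rw [← h, ← h']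
      ring
    have := congrArg (restrict (RingHom.id ParamRing)) key
    rw [restrict_sum_target, map_add, map_mul, map_mul, genericPoly, restrict_pderiv_zero,
      restrict_pderiv_one] at this
    obtain ⟨h₀, h₁⟩ := eq_zero_of_eq_combination _ isUnit_three (by compute_degree)
      (by compute_degree) (Or.inr (by simp [coeff_restrict_ansatz₂])) this
    intro j
    -- A zero constant term is added so that the quartic lemma applies.
    have h₀' : ∀ a : ParamRing, a = 0 → (.C a + (.C ((A i - A' i) 0) * .X
        + .C ((A i - A' i) 1) * .X ^ 2 + .C ((A i - A' i) 2) * .X ^ 3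
        + .C ((A i - A' i) 3) * .X ^ 4) : Polynomial ParamRing) = 0 := by
      rintro a rfl
      rw [Polynomial.C_0, zero_add]
      exact h₀
    obtain ⟨-, c0, c1, c2, c3⟩ := coeffs_eq_zero_of_quartic_eq_zero
      (by simpa only [add_assoc] using h₀' 0 rfl)
    obtain ⟨c4, c5, c6⟩ := coeffs_eq_zero_of_quadratic_eq_zero h₁
    fin_cases j
    exacts [c0, c1, c2, c3, c4, c5, c6]
  ext1 i j
  exact sub_eq_zero.1 (hd i j)

theorem isEliminationMatrix_iff (A : Matrix (Fin 7) (Fin 7) ParamRing) :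
    IsEliminationMatrix A ↔ A = elimMatrix :=
  ⟨fun h => h.unique isEliminationMatrix_elimMatrix, fun h => h ▸ isEliminationMatrix_elimMatrix⟩

end Uniqueness

/-! ### Vanishing determinant implies a singular surface -/

section Singular

/-- The Nullstellensatz for the equations of a singular point. -/
theorem exists_combination_eq_one {p : Fin 7 → ℂ} (hp : p ∉ singularParams) :
    ∃ q₀ q₁ q₂ q₃ : MvPolynomial (Fin 3) ℂ,
      q₀ * familyPoly p + q₁ * pderiv 0 (familyPoly p) + q₂ * pderiv 1 (familyPoly p)
        + q₃ * pderiv 2 (familyPoly p) = 1 := by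
  set I : Ideal (MvPolynomial (Fin 3) ℂ) := Ideal.span {familyPoly p, pderiv 0 (familyPoly p),
    pderiv 1 (familyPoly p), pderiv 2 (familyPoly p)} with hI
  have h1 : (1 : MvPolynomial (Fin 3) ℂ) ∈ I := by
    rw [← Ideal.eq_top_iff_one]
    by_contra hne
    obtain ⟨M, hM, hle⟩ := Ideal.exists_le_maximal I hne
    obtain ⟨v, rfl⟩ := MvPolynomial.isMaximal_iff_eq_vanishingIdeal_singleton.1 hM
    have hv : ∀ q ∈ I, eval v q = 0 := fun q hq => by
      have := hle hq
      simpa [MvPolynomial.mem_vanishingIdeal_singleton_iff] using this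
    exact hp ⟨v, hv _ (Ideal.subset_span (by simp)), hv _ (Ideal.subset_span (by simp)),
      hv _ (Ideal.subset_span (by simp)), hv _ (Ideal.subset_span (by simp))⟩
  simp only [hI, Ideal.mem_span_insert, Ideal.mem_span_singleton'] at h1
  obtain ⟨q₀, _, ⟨q₁, _, ⟨q₂, _, ⟨q₃, rfl⟩, rfl⟩, rfl⟩, h⟩ := h1
  exact ⟨q₀, q₁, q₂, q₃, by rw [h]; ring⟩

theorem eval_comp_X (p : Fin 7 → ℂ) : (eval p : ParamRing →+* ℂ) ∘ X = p := by
  ext i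
  simp

theorem mem_singularParams_of_det_eq_zero {p : Fin 7 → ℂ} (h : (integralMatrix p).det = 0) :
    p ∈ singularParams := by
  by_contra hp
  obtain ⟨q₀, q₁, q₂, q₃, hq⟩ := exists_combination_eq_one hp
  obtain ⟨a, ha, hE⟩ := Matrix.exists_vecMul_eq_zero_iff.2 h
  choose b c hr using exists_reduces
  set k : Fin 7 → ParamRing := fun i => C (a i) with hk
  set φ : ParamRing →+* ℂ := eval p with hφ
  have hq' := congrArg (restrict (RingHom.id ℂ)) hq
  simp only [map_add, map_mul, restrict_pderiv_zero, restrict_pderiv_one, pderiv_two_familyPoly,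
    restrict_X_two, mul_zero, add_zero, map_one, RingHom.coe_id, Function.id_comp] at hq'
  have hf : restrict φ (genericPoly + X 2 ^ 2) = restrict (RingHom.id ℂ) (familyPoly p) := by
    simp [genericPoly, familyPoly, restrict_C, restrict_X_zero, restrict_X_one, restrict_X_two, hφ]
  have hsum : restrict φ (∑ i, C (k i * (rowScale i : ParamRing)) * sourceMonomial i)
      * restrict (RingHom.id ℂ) (familyPoly p)
      + restrict φ (∑ i, C (k i) * ansatz₂ (b i)) * curveX p
      + restrict φ (∑ i, C (k i) * ansatz₃ (c i)) * curveY p = 0 := by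
    have h1 : (∑ i, C (k i * (rowScale i : ParamRing)) * sourceMonomial i)
        * (genericPoly + X 2 ^ 2) + (∑ i, C (k i) * ansatz₂ (b i)) * pderiv 0 genericPoly
        + (∑ i, C (k i) * ansatz₃ (c i)) * pderiv 1 genericPoly
        = ∑ j, C (∑ i, k i * integralMatrix X i j) * targetMonomial j := by
      simp only [map_sum, Finset.sum_mul, ← Finset.sum_add_distrib]
      rw [Finset.sum_comm]
      refine Finset.sum_congr rfl fun i _ => ?_
      simp only [C_mul, mul_assoc]
      rw [← Finset.mul_sum, ← hr i, map_natCast]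
      ring
    have h2 := congrArg (restrict φ) h1
    have h3 : ∀ j, φ (∑ i, k i * integralMatrix X i j) = 0 := by
      intro j
      have h4 : ∀ i, φ (integralMatrix X i j) = integralMatrix p i j := fun i => by
        rw [← eval_comp_X p, ← map_integralMatrix]
        rfl
      have h5 := congrFun hE j
      simpa [hk, hφ, ← h4, Matrix.vecMul, dotProduct] using h5
    rw [restrict_sum_target] at h2
    rw [map_add, map_add, map_mul, map_mul, map_mul, hf, genericPoly, restrict_pderiv_zero,
      restrict_pderiv_one, hφ, eval_comp_X] at h2
    rw [h2]
    simp only [← hφ, h3, map_zero, zero_mul, add_zero]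
  set G := restrict φ (∑ i, C (k i * (rowScale i : ParamRing)) * sourceMonomial i) with hG
  -- `G` times the Nullstellensatz identity, with `G * f` replaced through `hsum`, places `G` in the
  -- ideal of the two derivatives.
  have key : (restrict (RingHom.id ℂ) q₁ * G
        - restrict (RingHom.id ℂ) q₀ * restrict φ (∑ i, C (k i) * ansatz₂ (b i))) * curveX p
      + (restrict (RingHom.id ℂ) q₂ * G
        - restrict (RingHom.id ℂ) q₀ * restrict φ (∑ i, C (k i) * ansatz₃ (c i))) * curveY p
      = G := by
    linear_combination G * hq' - restrict (RingHom.id ℂ) q₀ * hsum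
  rw [restrict_sum_source] at hG
  obtain ⟨h₀, h₁⟩ := eq_zero_of_eq_combination p (IsUnit.mk0 3 three_ne_zero)
    (by compute_degree) (by compute_degree!) (Or.inl (by compute_degree)) (key.trans hG)
  apply ha
  ext i
  have h₁' : ∀ c : ℂ, c = 0 → (.C (φ (k 5 * (rowScale 5 : ParamRing)))
      + .C (φ (k 6 * (rowScale 6 : ParamRing))) * .X + .C c * .X ^ 2 : Polynomial ℂ) = 0 := by
    rintro c rfl
    rw [Polynomial.C_0, zero_mul, add_zero]
    exact h₁
  obtain ⟨c0, c1, c2, c3, c4⟩ := coeffs_eq_zero_of_quartic_eq_zero h₀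
  obtain ⟨c5, c6, -⟩ := coeffs_eq_zero_of_quadratic_eq_zero (h₁' 0 rfl)
  have hφk : ∀ i, φ (k i * (rowScale i : ParamRing)) = a i * rowScale i := fun i => by
    simp [hk, hφ]
  have hz : ∀ i, a i * (rowScale i : ℂ) = 0 := fun i => by
    rw [← hφk]
    fin_cases i
    exacts [c0, c1, c2, c3, c4, c5, c6]
  exact (mul_eq_zero.1 (hz i)).resolve_right (rowScale_ne_zero i)

end Singular

/-! ### Quasi-homogeneity of the matrix and its determinant -/

section Scaling

/-- The weights of the parameters `s₃, t₁, t₂, t₃, t₄, t₅, t₇`. -/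
def paramWeight : Fin 7 → ℕ := ![3, 1, 2, 3, 4, 5, 7]

/-- The weights of the rows of the elimination matrix. -/
def rowWeight : Fin 7 → ℕ := ![9, 11, 13, 15, 17, 12, 14]

/-- The weights of the columns of the elimination matrix. -/
def colWeight : Fin 7 → ℕ := ![2, 4, 6, 8, 3, 5, 7]

variable {S : Type*} [CommRing S]

theorem xStep_scale (l : S) (p e e' : Fin 7 → S) (r : ℕ)
    (h : ∀ j, e' j * l ^ colWeight j = l ^ r * e j) (j : Fin 7) :
    xStep (fun i => p i * l ^ paramWeight i) e' j * l ^ colWeight j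
      = l ^ (r + 2) * xStep p e j := by
  have h0 := h 0
  have h1 := h 1
  have h2 := h 2
  have h3 := h 3
  have h4 := h 4
  have h5 := h 5
  have h6 := h 6
  simp [colWeight] at h0 h1 h2 h3 h4 h5 h6
  fin_cases j <;> simp [xStep, colWeight, paramWeight]
  · linear_combination -(4 * p 1 * p 6 + p 4 ^ 2) * l ^ 2 * h3 - p 6 * l ^ 2 * h6
  · linear_combination 3 * l ^ 2 * h0 - (8 * p 1 * p 5 + 3 * p 2 * p 4) * l ^ 2 * h3
      - 2 * p 5 * l ^ 2 * h6
  · linear_combination 3 * l ^ 2 * h1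
      - (12 * p 1 * p 3 + 2 * p 2 ^ 2 + 4 * p 4) * l ^ 2 * h3 - 3 * p 3 * l ^ 2 * h6
  · linear_combination 3 * l ^ 2 * h2 - (16 * p 1 ^ 2 + 5 * p 2) * l ^ 2 * h3
      - 4 * p 1 * l ^ 2 * h6
  · linear_combination -(2 * p 0 * p 4 - 3 * p 6) * l ^ 2 * h3
  · linear_combination 3 * l ^ 2 * h4
      - (4 * p 0 * p 2 + 4 * p 1 * p 4 - 6 * p 5) * l ^ 2 * h3 - p 4 * l ^ 2 * h6
  · linear_combination 3 * l ^ 2 * h5 - (6 * p 0 + 8 * p 1 * p 2 - 9 * p 3) * l ^ 2 * h3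
      - 2 * p 2 * l ^ 2 * h6

theorem integralMatrix_scale (l : S) (p : Fin 7 → S) (i j : Fin 7) :
    integralMatrix (fun i => p i * l ^ paramWeight i) i j * l ^ colWeight j
      = l ^ rowWeight i * integralMatrix p i j := by
  have h₀ : ∀ j, rowOne (fun i => p i * l ^ paramWeight i) j * l ^ colWeight j
      = l ^ 9 * rowOne p j := by
    intro j
    fin_cases j <;> simp [rowOne, colWeight, paramWeight] <;> ring
  have h₅ : ∀ j, rowY (fun i => p i * l ^ paramWeight i) j * l ^ colWeight j
      = l ^ 12 * rowY p j := by
    intro j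
    fin_cases j <;> simp [rowY, colWeight, paramWeight] <;> ring
  have h₁ := xStep_scale l p _ _ _ h₀
  have h₂ := xStep_scale l p _ _ _ h₁
  have h₃ := xStep_scale l p _ _ _ h₂
  have h₄ := xStep_scale l p _ _ _ h₃
  have h₆ := xStep_scale l p _ _ _ h₅
  fin_cases i
  exacts [h₀ j, h₁ j, h₂ j, h₃ j, h₄ j, h₅ j, h₆ j]

/-- The weight 56 is the sum 91 of the row weights minus the sum 35 of the column weights. -/
theorem det_integralMatrix_scale [IsDomain S] {l : S} (hl : l ≠ 0) (p : Fin 7 → S) :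
    (integralMatrix fun i => p i * l ^ paramWeight i).det = l ^ 56 * (integralMatrix p).det := by
  have h : Matrix.of (fun i j => l ^ colWeight j *
      integralMatrix (fun i => p i * l ^ paramWeight i) i j)
      = Matrix.of fun i j => l ^ rowWeight i * integralMatrix p i j := by
    ext i j
    simp only [Matrix.of_apply]
    rw [← integralMatrix_scale, mul_comm]
  have h' := congrArg Matrix.det h
  rw [Matrix.det_mul_row, Matrix.det_mul_column, Finset.prod_pow_eq_pow_sum,
    Finset.prod_pow_eq_pow_sum] at h'
  have hc : ∑ j, colWeight j = 35 := by simp [colWeight, Fin.sum_univ_succ]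
  have hr : ∑ j, rowWeight j = 35 + 56 := by simp [rowWeight, Fin.sum_univ_succ]
  rw [hc, hr, pow_add, mul_assoc] at h'
  exact mul_left_cancel₀ (pow_ne_zero _ hl) h'

end Scaling

/-! ### Weighted homogeneity read off from a scaling variable -/

section Homogeneous

variable {σ K : Type*} [Fintype σ] [CommRing K]

/-- The substitution `X i ↦ X i * l ^ w i`. -/
def scaleHom (w : σ → ℕ) : MvPolynomial σ K →+* Polynomial (MvPolynomial σ K) :=
  eval₂Hom (Polynomial.C.comp C) fun i => .C (X i) * .X ^ w i

theorem scaleHom_monomial (w : σ → ℕ) (d : σ →₀ ℕ) (a : K) :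
    scaleHom w (monomial d a) = .C (monomial d a) * .X ^ ∑ i, w i * d i := by
  rw [scaleHom, coe_eval₂Hom, eval₂_monomial, Finsupp.prod_fintype _ _ (by simp)]
  simp only [mul_pow, ← pow_mul, Finset.prod_mul_distrib, Finset.prod_pow_eq_pow_sum]
  rw [monomial_eq, Finsupp.prod_fintype _ _ (by simp)]
  simp [mul_assoc]

theorem coeff_coeff_scaleHom (w : σ → ℕ) (q : MvPolynomial σ K) (d : σ →₀ ℕ) (n : ℕ) :
    coeff d ((scaleHom w q).coeff n) = if n = ∑ i, w i * d i then coeff d q else 0 := by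
  classical
  induction q using MvPolynomial.induction_on' with
  | monomial u a =>
    rw [scaleHom_monomial, Polynomial.coeff_C_mul_X_pow]
    by_cases hu : u = d
    · subst hu
      split_ifs <;> simp
    · rw [coeff_monomial, if_neg hu]
      split_ifs <;> simp [coeff_monomial, hu]
  | add p q hp hq =>
    rw [map_add, Polynomial.coeff_add, coeff_add, hp, hq, coeff_add]
    split_ifs <;> simp

theorem sum_weight_eq_of_scaleHom_eq {w : σ → ℕ} {q : MvPolynomial σ K} {n : ℕ}
    (h : scaleHom w q = .X ^ n * .C q) {d : σ →₀ ℕ} (hd : coeff d q ≠ 0) :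
    ∑ i, w i * d i = n := by
  by_contra hne
  have := coeff_coeff_scaleHom w q d n
  rw [h, if_neg (Ne.symm hne), Polynomial.coeff_X_pow_mul', if_pos le_rfl, Nat.sub_self,
    Polynomial.coeff_C_zero] at this
  exact hd this

end Homogeneous

/-! ### The discriminant polynomial is monic of degree 7 in `t₇` -/

section Leading

/-- A polynomial in the parameters, as a polynomial in `t₇`. -/
def toPoly : ParamRing →+* Polynomial (MvPolynomial (Fin 6) ℂ) :=
  eval₂Hom (Polynomial.C.comp C) (Fin.snoc (fun i => .C (X i)) .X)

/-- The inverse of `toPoly`. -/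
def ofPoly : Polynomial (MvPolynomial (Fin 6) ℂ) →+* ParamRing :=
  Polynomial.eval₂RingHom (rename Fin.castSucc : _ →ₐ[ℂ] _).toRingHom (X 6)

theorem toPoly_X_six : toPoly (X 6) = .X := by
  simp only [toPoly, coe_eval₂Hom, eval₂_X]
  exact Fin.snoc_last (α := fun _ => Polynomial (MvPolynomial (Fin 6) ℂ)) _ _

theorem toPoly_X_castSucc (i : Fin 6) : toPoly (X i.castSucc) = .C (X i) := by
  simp only [toPoly, coe_eval₂Hom, eval₂_X]
  exact Fin.snoc_castSucc (α := fun _ => Polynomial (MvPolynomial (Fin 6) ℂ)) _ _ _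

theorem toPoly_C (a : ℂ) : toPoly (C a) = .C (C a) := by
  simp [toPoly]

theorem ofPoly_toPoly (q : ParamRing) : ofPoly (toPoly q) = q := by
  have : ofPoly.comp toPoly = RingHom.id _ := by
    apply MvPolynomial.ringHom_ext
    · intro r
      simp [toPoly_C, ofPoly]
    · intro i
      refine Fin.lastCases ?_ (fun i => ?_) i
      · change ofPoly (toPoly (X 6)) = X 6
        simp [toPoly_X_six, ofPoly]
      · simp [toPoly_X_castSucc, ofPoly]
  exact RingHom.congr_fun this q

theorem natDegree_toPoly_monomial_le (d : Fin 7 →₀ ℕ) (a : ℂ) :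
    (toPoly (monomial d a)).natDegree ≤ d 6 := by
  rw [monomial_eq, Finsupp.prod_fintype _ _ (by simp), Fin.prod_univ_castSucc, map_mul, map_mul,
    toPoly_C, map_prod, map_pow]
  have : ∏ i : Fin 6, toPoly (X i.castSucc ^ d i.castSucc)
      = .C (∏ i : Fin 6, X i ^ d i.castSucc) := by
    simp [toPoly_X_castSucc]
  rw [this, ← mul_assoc, ← Polynomial.C_mul]
  refine (Polynomial.natDegree_C_mul_le _ _).trans ?_
  change (toPoly (X 6) ^ d 6).natDegree ≤ d 6
  rw [toPoly_X_six]
  exact Polynomial.natDegree_X_pow_le _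

/-- Since `t₇` has weight 7 and all weights are positive, a monomial of weight 49 other than `t₇⁷`
has degree at most 6 in `t₇` and involves another variable. -/
theorem exists_leading_of_weight {q : ParamRing}
    (hq : ∀ d : Fin 7 →₀ ℕ, coeff d q ≠ 0 → ∑ i, paramWeight i * d i = 49) :
    ∃ (k : ℂ) (q' : ParamRing), q = C k * X 6 ^ 7 + q' ∧ (toPoly q').natDegree ≤ 6 ∧
      ∀ a : Fin 7 → ℂ, (∀ i, i ≠ 6 → a i = 0) → eval a q' = 0 := by
  classical
  set d₀ : Fin 7 →₀ ℕ := Finsupp.single 6 7 with hd₀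
  refine ⟨coeff d₀ q, ∑ d ∈ q.support.erase d₀, monomial d (coeff d q), ?_, ?_, ?_⟩
  · have h1 : C (coeff d₀ q) * X 6 ^ 7 = monomial d₀ (coeff d₀ q) := by
      rw [C_mul_X_pow_eq_monomial]
    rw [h1]
    conv_lhs => rw [q.as_sum]
    by_cases h : d₀ ∈ q.support
    · exact (Finset.add_sum_erase _ (fun d => monomial d (coeff d q)) h).symm
    · rw [Finset.erase_eq_of_notMem h, notMem_support_iff.1 h]
      simp
  all_goals
    have hlow : ∀ d ∈ q.support.erase d₀, d 6 ≤ 6 := by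
      intro d hd
      rw [Finset.mem_erase, mem_support_iff] at hd
      have hw := hq d hd.2
      by_contra h6
      apply hd.1
      simp [Fin.sum_univ_succ, paramWeight] at hw
      ext i
      fin_cases i <;> simp [hd₀] <;> omega
  · rw [map_sum]
    exact Polynomial.natDegree_sum_le_of_forall_le _ _ fun d hd =>
      (natDegree_toPoly_monomial_le _ _).trans (hlow d hd)
  · intro a ha
    rw [map_sum]
    refine Finset.sum_eq_zero fun d hd => ?_
    have hw := hq d (mem_support_iff.1 (Finset.mem_of_mem_erase hd))
    have h6 := hlow d hd
    obtain ⟨i, hi, hdi⟩ : ∃ i, i ≠ 6 ∧ d i ≠ 0 := by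
      by_contra hcon
      push Not at hcon
      rw [Finset.sum_eq_single 6 (fun i _ hi => by rw [hcon i hi, mul_zero]) (by simp)] at hw
      simp [paramWeight] at hw
      omega
    rw [eval_monomial, Finsupp.prod_fintype _ _ (by simp),
      Finset.prod_eq_zero (Finset.mem_univ i) (by rw [ha i hi, zero_pow hdi]), mul_zero]

theorem det_integralMatrix_single :
    (integralMatrix (Pi.single 6 1 : Fin 7 → ℂ)).det ≠ 0 := by
  have : integralMatrix (Pi.single 6 1 : Fin 7 → ℂ)
      = Matrix.diagonal ![7, 21, 63, 189, 567, 63, 189] := by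
    ext i j
    fin_cases i <;> fin_cases j <;> simp [integralMatrix, xStep, rowOne, rowY] <;> norm_num
  rw [this, Matrix.det_diagonal]
  simp [Fin.prod_univ_succ]

theorem X_six_dvd_det : (X 6 : ParamRing) ∣ (integralMatrix X).det := by
  have h := dvd_two_mul_det_integralMatrix (X : Fin 7 → ParamRing)
  -- The prime `t₇` does not divide `2s₃`: evaluate at `s₃ = 1`, all other parameters zero.
  refine (X_prime (i := (6 : Fin 7)).dvd_or_dvd h).resolve_left ?_
  rintro ⟨q, hq⟩
  have := congrArg (eval (Pi.single 0 1 : Fin 7 → ℂ)) hq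
  simp at this

theorem exists_discriminant : ∃ (k : ℂ) (δ : ParamRing), k ≠ 0 ∧
    (integralMatrix X : Matrix _ _ ParamRing).det = C k * X 6 * δ ∧ (toPoly δ).Monic ∧
    (toPoly δ).natDegree = 7 := by
  obtain ⟨δ₁, h₁⟩ := X_six_dvd_det
  have hs : scaleHom paramWeight (integralMatrix X : Matrix _ _ ParamRing).det
      = .X ^ 56 * .C (integralMatrix X).det := by
    rw [RingHom.map_det, RingHom.map_det, RingHom.mapMatrix_apply, RingHom.mapMatrix_apply,
      map_integralMatrix, map_integralMatrix, ← det_integralMatrix_scale Polynomial.X_ne_zero]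
    congr 2
    ext1 i
    simp [scaleHom]
  have hs₁ : scaleHom paramWeight δ₁ = .X ^ 49 * .C δ₁ := by
    have h6 : scaleHom paramWeight (X 6 : ParamRing) = .C (X 6) * .X ^ 7 := by
      simp [scaleHom, paramWeight]
    rw [h₁, map_mul, map_mul, h6] at hs
    have hne : (Polynomial.C (X 6 : ParamRing) * Polynomial.X ^ 7) ≠ 0 :=
      mul_ne_zero (by simp)
        (pow_ne_zero _ Polynomial.X_ne_zero)
    refine mul_left_cancel₀ hne ?_
    rw [hs]
    ring
  obtain ⟨k, q, hq, hdeg, hz⟩ := exists_leading_of_weight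
    fun d hd => sum_weight_eq_of_scaleHom_eq hs₁ hd
  -- At `t₇ = 1`, all other parameters zero, only the `t₇⁷` term survives, and the matrix is
  -- diagonal and invertible.
  have hk : k ≠ 0 := by
    rintro rfl
    apply det_integralMatrix_single
    have h2 := congrArg (eval (Pi.single 6 1 : Fin 7 → ℂ)) h₁
    rw [hq, RingHom.map_det, RingHom.mapMatrix_apply, map_integralMatrix, eval_comp_X, map_mul,
      map_add, hz _ (fun i hi => by simp [hi])] at h2
    simp [h2]
  have hδ : toPoly (C k⁻¹ * δ₁) = .X ^ 7 + .C (C k⁻¹) * toPoly q := by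
    rw [hq, mul_add, ← mul_assoc, ← C_mul, inv_mul_cancel₀ hk, C_1, one_mul, map_add, map_pow,
      toPoly_X_six, map_mul, toPoly_C]
  have hlow : (Polynomial.C (C k⁻¹) * toPoly q).degree < ((7 : ℕ) : WithBot ℕ) := by
    refine Polynomial.degree_lt_degree ?_ |>.trans_eq (Polynomial.degree_X_pow 7)
    rw [Polynomial.natDegree_X_pow]
    exact Nat.lt_succ_of_le ((Polynomial.natDegree_C_mul_le _ _).trans hdeg)
  refine ⟨k, C k⁻¹ * δ₁, hk, ?_, ?_, ?_⟩
  · rw [h₁]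
    have : C k * C k⁻¹ = (1 : ParamRing) := by rw [← C_mul, mul_inv_cancel₀ hk, C_1]
    linear_combination -(X 6 * δ₁) * this
  · rw [hδ]
    exact Polynomial.monic_X_pow_add hlow
  · rw [hδ, Polynomial.natDegree_add_eq_left_of_degree_lt, Polynomial.natDegree_X_pow]
    rwa [Polynomial.degree_X_pow]

theorem sum_Icc_sub {M : Type*} [AddCommMonoid M] (f : ℕ → M) (n : ℕ) :
    ∑ j ∈ Finset.Icc 1 n, f (n - j) = ∑ i ∈ Finset.range n, f i := by
  refine Finset.sum_nbij' (fun j => n - j) (fun i => n - i) ?_ ?_ ?_ ?_ fun _ _ => rfl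
  all_goals
    intro i hi
    simp only [Finset.mem_range, Finset.mem_Icc] at hi ⊢
    omega

theorem eq_sum_of_toPoly_monic {δ : ParamRing} (hm : (toPoly δ).Monic)
    (hd : (toPoly δ).natDegree = 7) : ∃ B : ℕ → MvPolynomial (Fin 6) ℂ,
      δ = X 6 ^ 7 + ∑ j ∈ Finset.Icc 1 7, rename Fin.castSucc (B j) * X 6 ^ (7 - j) := by
  refine ⟨fun j => (toPoly δ).coeff (7 - j), ?_⟩
  have h := congrArg ofPoly hm.as_sum
  rw [ofPoly_toPoly, hd] at h
  conv_lhs => rw [h]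
  rw [map_add, map_sum, map_pow]
  have hX : ofPoly Polynomial.X = X 6 := by simp [ofPoly]
  have hC : ∀ b, ofPoly (.C b) = rename Fin.castSucc b := fun b => by simp [ofPoly]
  simp only [map_mul, map_pow, hX, hC]
  rw [sum_Icc_sub fun i => rename Fin.castSucc ((toPoly δ).coeff i) * X 6 ^ i]

end Leading

/-! ### The determinant on the line `s₃ = t₅ = 1`, `t₁ = t₂ = t₃ = t₄ = 0` -/

section SpecialDeterminant
variable {S : Type*} [CommRing S]

theorem xStep_special (t : S) (e : Fin 7 → S) : xStep ![1, 0, 0, 0, 0, 1, t] e =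
    ![-t * e 6, 3 * e 0 - 2 * e 6, 3 * e 1, 3 * e 2, 3 * t * e 3, 3 * e 4 + 6 * e 3,
      3 * e 5 - 6 * e 3] := by
  ext j
  fin_cases j <;> simp [xStep]

theorem integralMatrix_special (t : S) : integralMatrix ![1, 0, 0, 0, 0, 1, t] =
    !![7 * t, 5, -1, 0, -2, 0, 0;
      0, 21 * t, 15, -3, 0, -6, 0;
      0, 0, 63 * t, 45, -9 * t, -18, 0;
      0, 0, 0, 189 * t, 135 * t, -27 * t + 270, -324;
      324 * t, 648, 0, 0, 567 * t ^ 2, 1539 * t, -1215 * t + 810;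
      3 * t, 6, 6, 0, 12, 63 * t, 45;
      -45 * t, 9 * t - 90, 18, 18, 0, 36, 189 * t] := by
  have h₀ : rowOne ![1, 0, 0, 0, 0, 1, t] =
      ![7 * t, 5, -1, 0, -2, 0, 0] := by
    ext j
    fin_cases j <;> simp [rowOne]
  have h₅ : rowY ![1, 0, 0, 0, 0, 1, t] =
      ![3 * t, 6, 6, 0, 12, 63 * t, 45] := by
    ext j
    fin_cases j <;> simp [rowY]
  have h₁ : xStep ![1, 0, 0, 0, 0, 1, t] ![7 * t, 5, -1, 0, -2, 0, 0] =
      ![0, 21 * t, 15, -3, 0, -6, 0] := by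
    rw [xStep_special]
    ext j
    fin_cases j <;> simp <;> ring
  have h₂ : xStep ![1, 0, 0, 0, 0, 1, t] ![0, 21 * t, 15, -3, 0, -6, 0] =
      ![0, 0, 63 * t, 45, -9 * t, -18, 0] := by
    rw [xStep_special]
    ext j
    fin_cases j <;> simp <;> ring
  have h₃ : xStep ![1, 0, 0, 0, 0, 1, t] ![0, 0, 63 * t, 45, -9 * t, -18, 0] =
      ![0, 0, 0, 189 * t, 135 * t, -27 * t + 270, -324] := by
    rw [xStep_special]
    ext j
    fin_cases j <;> simp <;> ring
  have h₄ : xStep ![1, 0, 0, 0, 0, 1, t] ![0, 0, 0, 189 * t, 135 * t, -27 * t + 270, -324] =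
      ![324 * t, 648, 0, 0, 567 * t ^ 2, 1539 * t, -1215 * t + 810] := by
    rw [xStep_special]
    ext j
    fin_cases j <;> simp <;> ring
  have h₆ : xStep ![1, 0, 0, 0, 0, 1, t] ![3 * t, 6, 6, 0, 12, 63 * t, 45] =
      ![-45 * t, 9 * t - 90, 18, 18, 0, 36, 189 * t] := by
    rw [xStep_special]
    ext j
    fin_cases j <;> simp <;> ring
  rw [integralMatrix, h₀, h₁, h₂, h₃, h₄, h₅, h₆]

theorem det_integralMatrix_special (t : S) : (integralMatrix ![1, 0, 0, 0, 0, 1, t]).det =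
    14348907 * t * (823543 * t ^ 7 - 540225 * t ^ 5 - 67225 * t ^ 4 - 248625 * t ^ 3
      - 93231 * t ^ 2 + 180000 * t + 77648) := by
  rw [integralMatrix_special]
  simp [Matrix.det_succ_row_zero, Fin.sum_univ_succ, Fin.succAbove]
  ring

end SpecialDeterminant

/-! ### Parametrization of singular surfaces by a singular point -/

section Nodes

variable {S : Type*} [CommRing S]

/-- The parameters, with given `s₃, t₁, t₂, t₃`, for which `(x, xw, 0)` is a singular point. -/
def nodeParams (x w s₃ t₁ t₂ t₃ : S) : Fin 7 → S :=
  let t₄ := -(3 * x * w ^ 2 + 2 * s₃ * w + x ^ 2 + t₂ * x)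
  let t₅ := x * w ^ 3 + s₃ * w ^ 2 - 2 * x ^ 2 * w - 2 * t₃ * x - 3 * t₁ * x ^ 2 - t₂ * x * w
  ![s₃, t₁, t₂, t₃, t₄, t₅, -(x ^ 2 * w ^ 3 + s₃ * x * w ^ 2 + x ^ 3 * w + t₅ * x + t₃ * x ^ 2
    + t₁ * x ^ 3 + t₄ * x * w + t₂ * x ^ 2 * w)]

/-- The parametrization of the singular surfaces by the position of a singular point. -/
def nodeHom : ParamRing →+* MvPolynomial (Fin 6) ℂ :=
  eval₂Hom C (nodeParams (X 0) (X 1) (X 2) (X 3) (X 4) (X 5))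

theorem eval_nodeHom (u : Fin 6 → ℂ) (q : ParamRing) :
    eval u (nodeHom q) = eval (nodeParams (u 0) (u 1) (u 2) (u 3) (u 4) (u 5)) q := by
  have : (eval u).comp nodeHom = eval (nodeParams (u 0) (u 1) (u 2) (u 3) (u 4) (u 5)) := by
    apply MvPolynomial.ringHom_ext
    · intro r
      simp [nodeHom]
    · intro i
      fin_cases i <;> simp [nodeHom, nodeParams, map_ofNat]
  exact RingHom.congr_fun this q

theorem nodeHom_det : nodeHom (integralMatrix X).det = 0 := by
  refine map_det_integralMatrix_eq_zero nodeHom ![X 0, X 0 * X 1, 0] ?_ ?_ ?_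
    (Or.inl (by simp))
  · simp [genericPoly, familyPoly, nodeHom, nodeParams]
    ring
  · simp [genericPoly, pderiv_zero_familyPoly, nodeHom, nodeParams, eval₂_ofNat]
    ring
  · simp [genericPoly, pderiv_one_familyPoly, nodeHom, nodeParams, eval₂_ofNat]
    ring

theorem nodeHom_X_six_ne_zero : nodeHom (X 6) ≠ 0 := by
  intro h
  have := congrArg (eval ![1, 1, 0, 0, 0, 0]) h
  rw [eval_nodeHom] at this
  simp [nodeParams] at this
  norm_num at this

/-- With `y = xw`, the equations `∂_y f = 0` and `f = 0` are divisible by `x`, and all three can be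
solved polynomially for `t₄, t₅, t₇`. -/
theorem exists_nodeParams_eq {p : Fin 7 → ℂ} (hp : p ∈ singularParams) (h6 : p 6 ≠ 0) :
    ∃ x w, p = nodeParams x w (p 0) (p 1) (p 2) (p 3) := by
  obtain ⟨v, hf, hx, hy, hz⟩ := hp
  rw [pderiv_zero_familyPoly] at hx
  rw [pderiv_one_familyPoly] at hy
  rw [pderiv_two_familyPoly] at hz
  simp [familyPoly, map_ofNat] at hf hx hy hz
  rw [hz] at hf
  set x := v 0
  set y := v 1
  -- At `x = 0` the equations `y²(y + s₃) = 0` and `y(3y + 2s₃) = 0` force `y = 0`, and then `∂ₓf =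
  -- t₇`.
  have hx0 : x ≠ 0 := by
    intro h0
    rw [h0] at hf hx hy
    have hy0 : y = 0 := by
      by_contra hne
      have h1 : y + p 0 = 0 := by
        apply mul_left_cancel₀ (pow_ne_zero 2 hne)
        linear_combination hf
      have h2 : 3 * y + 2 * p 0 = 0 := by
        apply mul_left_cancel₀ hne
        linear_combination hy
      apply hne
      linear_combination h2 - 2 * h1
    rw [hy0] at hx
    apply h6
    linear_combination hx
  obtain ⟨w, hw⟩ : ∃ w, y = x * w := ⟨y / x, by field_simp⟩
  rw [hw] at hf hx hy
  have h4 : p 4 = -(3 * x * w ^ 2 + 2 * p 0 * w + x ^ 2 + p 2 * x) := by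
    apply mul_left_cancel₀ hx0
    linear_combination hy
  have h7 : p 6 = -(x ^ 2 * w ^ 3 + p 0 * x * w ^ 2 + x ^ 3 * w + p 5 * x + p 3 * x ^ 2
      + p 1 * x ^ 3 + p 4 * x * w + p 2 * x ^ 2 * w) := by
    apply mul_left_cancel₀ hx0
    linear_combination hf
  have h5 : p 5 = x * w ^ 3 + p 0 * w ^ 2 - 2 * x ^ 2 * w - 2 * p 3 * x - 3 * p 1 * x ^ 2
      - p 2 * x * w := by
    apply mul_left_cancel₀ hx0
    linear_combination hx - h7
  refine ⟨x, w, ?_⟩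
  ext i
  fin_cases i <;> simp only [nodeParams, Fin.mk_zero, Fin.mk_one, Fin.reduceFinMk, Matrix.cons_val]
  · exact h4
  · exact h5
  · rw [← h5, ← h4]
    exact h7

end Nodes

/-! ### Simple nonzero roots on the special line -/

section Special

/-- Up to a constant, the discriminant polynomial for `s₃ = t₅ = 1`, `t₁ = t₂ = t₃ = t₄ = 0`, as a
polynomial in `t₇`. -/
def specialPoly : Polynomial ℂ :=
  823543 * .X ^ 7 - 540225 * .X ^ 5 - 67225 * .X ^ 4 - 248625 * .X ^ 3 - 93231 * .X ^ 2
    + 180000 * .X + 77648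

theorem natDegree_specialPoly : specialPoly.natDegree = 7 := by
  unfold specialPoly
  compute_degree!

theorem specialPoly_eval_zero : specialPoly.eval 0 ≠ 0 := by
  simp [specialPoly]

theorem derivative_specialPoly : Polynomial.derivative specialPoly =
    5764801 * .X ^ 6 - 2701125 * .X ^ 4 - 268900 * .X ^ 3 - 745875 * .X ^ 2 - 186462 * .X
      + 180000 := by
  simp [specialPoly, map_ofNat]
  ring

theorem isCoprime_of_isUnit_combination {R : Type*} [CommRing R] {a b p q : R}
    (h : IsUnit (a * p + b * q)) : IsCoprime p q := by
  obtain ⟨r, hr⟩ := h.exists_left_inv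
  exact ⟨r * a, r * b, by rw [← hr]; ring⟩

/-- An explicit Bézout identity expresses a nonzero constant through the polynomial and its
derivative. -/
theorem separable_specialPoly : specialPoly.Separable := by
  have h :
      (1969186242397649806165269958089352885101566
        - 8625806237518136273644801212669812320955625 * .X
        + 15372416200022557729200872654755625507025180 * .X ^ 2
        - 29660870938771955172742427672700301346997375 * .X ^ 3
        + 25667132062102034757641074674603293137030200 * .X ^ 4
        - 4028508736708579168355596210275918122312925 * .X ^ 5 : Polynomial ℂ) * specialPoly
      + (-845829124844224553610571355586541783965000
        + 875600493458486008616047644444023964764437 * .X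
        + 416557627427547138844165043760775614646875 * .X ^ 2
        - 1528966591395009622553437059902480400226365 * .X ^ 3
        + 4129405735257488174212801246357426095025875 * .X ^ 4
        - 3666733151728862108234439239229041876718600 * .X ^ 5
        + 575501248101225595479370887182274017473275 * .X ^ 6)
        * Polynomial.derivative specialPoly
      = .C 654130877732292499218037700144551708666396768 := by
    rw [derivative_specialPoly, specialPoly, map_ofNat]
    ring
  have hu : IsUnit (.C 654130877732292499218037700144551708666396768 : Polynomial ℂ) :=
    Polynomial.isUnit_C.2 (IsUnit.mk0 _ (by norm_num))
  rw [← h] at hu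
  exact isCoprime_of_isUnit_combination hu

/-- Specialization to `s₃ = t₅ = 1`, `t₁ = t₂ = t₃ = t₄ = 0`. -/
def specialHom : ParamRing →+* Polynomial ℂ := eval₂Hom Polynomial.C ![1, 0, 0, 0, 0, 1, .X]

theorem eval_specialHom (q : ParamRing) (t : ℂ) :
    (specialHom q).eval t = eval ![1, 0, 0, 0, 0, 1, t] q := by
  have : (Polynomial.evalRingHom t).comp specialHom = eval ![1, 0, 0, 0, 0, 1, t] := by
    apply MvPolynomial.ringHom_ext
    · intro r
      simp [specialHom]
    · intro i
      fin_cases i <;> simp [specialHom]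
  exact RingHom.congr_fun this q

theorem natDegree_specialHom_le (q : ParamRing) :
    (specialHom q).natDegree ≤ (toPoly q).natDegree := by
  have : (Polynomial.mapRingHom (eval ![1, 0, 0, 0, 0, 1])).comp toPoly = specialHom := by
    apply MvPolynomial.ringHom_ext
    · intro r
      simp [specialHom, toPoly_C]
    · intro i
      refine Fin.lastCases ?_ (fun i => ?_) i
      · change Polynomial.mapRingHom _ (toPoly (X 6)) = specialHom (X 6)
        simp [toPoly_X_six, specialHom]
      · rw [RingHom.comp_apply, toPoly_X_castSucc]
        fin_cases i <;> simp [specialHom]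
  rw [← this]
  exact Polynomial.natDegree_map_le

theorem specialHom_det : specialHom (integralMatrix X).det = 14348907 * .X * specialPoly := by
  have h : specialHom ∘ X = ![1, 0, 0, 0, 0, 1, .X] := by
    ext1 i
    simp [specialHom]
  rw [RingHom.map_det, RingHom.mapMatrix_apply, map_integralMatrix, h,
    det_integralMatrix_special, specialPoly]

end Special

/-! ### Irreducibility of the discriminant polynomial -/

section Irreducibility

variable {k : ℂ} {δ : ParamRing}

theorem specialHom_discriminant
    (hδ : (integralMatrix X : Matrix _ _ ParamRing).det = C k * X 6 * δ) :
    14348907 * specialPoly = .C k * specialHom δ := by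
  have h := specialHom_det
  rw [hδ] at h
  apply mul_left_cancel₀ Polynomial.X_ne_zero
  simp only [map_mul] at h
  have h6 : specialHom (X 6) = .X := by simp [specialHom]
  have hC : specialHom (C k) = .C k := by simp [specialHom]
  rw [h6, hC] at h
  linear_combination -h

theorem eval_det_integralMatrix (p : Fin 7 → ℂ) :
    eval p (integralMatrix X : Matrix _ _ ParamRing).det = (integralMatrix p).det := by
  rw [RingHom.map_det, RingHom.mapMatrix_apply, map_integralMatrix, eval_comp_X]

/-- Each of the seven roots of `specialPoly` has `t₇ ≠ 0` and gives a singular surface, hence a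
point in the image of the parametrization, where `q` vanishes. -/
theorem seven_le_natDegree_of_nodeHom_eq_zero
    (hδ : (integralMatrix X : Matrix _ _ ParamRing).det = C k * X 6 * δ) {q : ParamRing}
    (hq : q ∣ δ) (h0 : nodeHom q = 0) : 7 ≤ (toPoly q).natDegree := by
  have hs := specialHom_discriminant hδ
  have hP : specialPoly ≠ 0 := fun h => by simpa [h] using natDegree_specialPoly
  have hq0 : specialHom q ≠ 0 := by
    intro h
    obtain ⟨r, rfl⟩ := hq
    rw [map_mul, h, zero_mul, mul_zero] at hs
    exact (mul_ne_zero (by norm_num) hP) hs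
  -- The roots are simple, so inclusion of root sets suffices for inclusion of multisets.
  have hsub : specialPoly.roots ≤ (specialHom q).roots := by
    rw [Multiset.le_iff_subset (Polynomial.nodup_roots separable_specialPoly)]
    intro t ht
    have ht0 : specialPoly.eval t = 0 := (Polynomial.mem_roots hP).1 ht
    have htne : t ≠ 0 := fun h => specialPoly_eval_zero (h ▸ ht0)
    rw [Polynomial.mem_roots hq0, Polynomial.IsRoot, eval_specialHom]
    have hdet : (integralMatrix ![1, 0, 0, 0, 0, 1, t]).det = 0 := by
      rw [← eval_det_integralMatrix, ← eval_specialHom, specialHom_det, Polynomial.eval_mul, ht0,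
        mul_zero]
    obtain ⟨x, w, hxw⟩ := exists_nodeParams_eq (mem_singularParams_of_det_eq_zero hdet)
      (by simpa using htne)
    have := eval_nodeHom ![x, w, 1, 0, 0, 0] q
    rw [h0, map_zero] at this
    rw [hxw]
    exact this.symm
  calc 7 = specialPoly.roots.card := by
        rw [← natDegree_specialPoly]
        exact (IsAlgClosed.splits specialPoly).natDegree_eq_card_roots
    _ ≤ (specialHom q).roots.card := Multiset.card_le_card hsub
    _ ≤ (specialHom q).natDegree := Polynomial.card_roots' _
    _ ≤ (toPoly q).natDegree := natDegree_specialHom_le q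

/-- The factor `a` uses up the whole degree in `t₇`, so `b` is free of `t₇`; monicity of the product
makes it a unit. -/
theorem isUnit_of_nodeHom_eq_zero
    (hδ : (integralMatrix X : Matrix _ _ ParamRing).det = C k * X 6 * δ)
    (hm : (toPoly δ).Monic) (hd : (toPoly δ).natDegree = 7) {a b : ParamRing} (hab : δ = a * b)
    (ha : nodeHom a = 0) : IsUnit b := by
  have h7 := seven_le_natDegree_of_nodeHom_eq_zero hδ ⟨b, hab⟩ ha
  rw [hab, map_mul] at hm hd
  rw [Polynomial.natDegree_mul (left_ne_zero_of_mul hm.ne_zero)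
    (right_ne_zero_of_mul hm.ne_zero)] at hd
  have hb : (toPoly b).natDegree = 0 := by omega
  rw [Polynomial.Monic, Polynomial.leadingCoeff_mul] at hm
  have hu : IsUnit (toPoly b) := by
    rw [Polynomial.eq_C_of_natDegree_eq_zero hb]
    rw [Polynomial.leadingCoeff, Polynomial.leadingCoeff, hb, mul_comm] at hm
    exact Polynomial.isUnit_C.2 (IsUnit.of_mul_eq_one _ hm)
  rw [← ofPoly_toPoly b]
  exact hu.map ofPoly

theorem irreducible_discriminant (hk : k ≠ 0)
    (hδ : (integralMatrix X : Matrix _ _ ParamRing).det = C k * X 6 * δ)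
    (hm : (toPoly δ).Monic) (hd : (toPoly δ).natDegree = 7) : Irreducible δ := by
  have h0 : nodeHom δ = 0 := by
    have h := nodeHom_det
    rw [hδ, map_mul, map_mul] at h
    refine (mul_eq_zero.1 h).resolve_left (mul_ne_zero ?_ nodeHom_X_six_ne_zero)
    simpa [nodeHom] using hk
  refine ⟨fun hu => ?_, fun a b hab => ?_⟩
  · have := Polynomial.natDegree_eq_zero_of_isUnit (hu.map toPoly)
    omega
  · rw [hab, map_mul, mul_eq_zero] at h0
    rcases h0 with h | h
    · exact Or.inr (isUnit_of_nodeHom_eq_zero hδ hm hd hab h)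
    · exact Or.inl (isUnit_of_nodeHom_eq_zero hδ hm hd (hab.trans (mul_comm a b)) h)

end Irreducibility

/-! ### The singular set and the restriction to `s₃ = 0` -/

section SingularSet

theorem det_eq_zero_of_mem_singularParams {p : Fin 7 → ℂ} (hp : p ∈ singularParams)
    (h6 : p 6 ≠ 0) : (integralMatrix p).det = 0 := by
  obtain ⟨x, w, h⟩ := exists_nodeParams_eq hp h6
  have := eval_nodeHom ![x, w, p 0, p 1, p 2, p 3] (integralMatrix X).det
  rw [nodeHom_det, map_zero] at this
  rw [← eval_det_integralMatrix, h]
  exact this.symm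

theorem singularParams_eq {k : ℂ} {δ : ParamRing} (hk : k ≠ 0)
    (hδ : (integralMatrix X : Matrix _ _ ParamRing).det = C k * X 6 * δ) :
    singularParams = {p : Fin 7 → ℂ | p 6 * eval p δ = 0} := by
  ext p
  have hdet : (integralMatrix p).det = k * (p 6 * eval p δ) := by
    rw [← eval_det_integralMatrix, hδ]
    simp [mul_assoc]
  rw [Set.mem_ofPred_eq]
  constructor
  · intro hp
    by_cases h6 : p 6 = 0
    · rw [h6, zero_mul]
    · have := det_eq_zero_of_mem_singularParams hp h6
      rw [hdet] at this
      exact (mul_eq_zero.1 this).resolve_left hk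
  · intro h
    apply mem_singularParams_of_det_eq_zero
    rw [hdet, h, mul_zero]

/-- At `s₃ = 0` the determinant is divisible by `t₇²`, because the prime `t₇` does not divide `t₄²`;
one factor is the explicit `t₇` of `hδ`. After the substitution `X 5` is `t₇` and `X 3` is `t₄`. -/
theorem exists_eq_mul_of_s_eq_zero {k : ℂ} {δ : ParamRing} (hk : k ≠ 0)
    (hδ : (integralMatrix X : Matrix _ _ ParamRing).det = C k * X 6 * δ) :
    ∃ q : MvPolynomial (Fin 6) ℂ,
      aeval (Fin.cons 0 X : Fin 7 → MvPolynomial (Fin 6) ℂ) δ = X 5 * q := by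
  set φ : ParamRing →ₐ[ℂ] MvPolynomial (Fin 6) ℂ :=
    aeval (Fin.cons 0 X : Fin 7 → MvPolynomial (Fin 6) ℂ) with hφ
  set p : Fin 7 → MvPolynomial (Fin 6) ℂ := Fin.cons 0 X with hp
  have hpX : φ.toRingHom ∘ X = p := by
    ext1 i
    simp [hφ, hp]
  have h6 : p 6 = X 5 := rfl
  have h4 : p 4 = X 3 := rfl
  have h := sq_dvd_mul_det_integralMatrix p rfl
  have hX : Prime (X 5 : MvPolynomial (Fin 6) ℂ) := X_prime
  have hndvd : ¬ (X 5 : MvPolynomial (Fin 6) ℂ) ∣ X 3 ^ 2 := by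
    intro hd
    obtain ⟨q, hq⟩ := hX.dvd_of_dvd_pow hd
    have := congrArg (eval (Pi.single 3 1 : Fin 6 → ℂ)) hq
    simp at this
  rw [h6, h4] at h
  obtain ⟨q, hq⟩ := hX.pow_dvd_of_dvd_mul_left 2 hndvd h
  have hdet : (integralMatrix p).det = C k * X 5 * φ δ := by
    have := congrArg φ.toRingHom hδ
    rw [RingHom.map_det, RingHom.mapMatrix_apply, map_integralMatrix, hpX, map_mul, map_mul] at this
    rw [this, ← h6, ← hpX]
    simp [hφ]
  refine ⟨C k⁻¹ * q, mul_left_cancel₀ (mul_ne_zero (C_ne_zero.2 hk) hX.ne_zero) ?_⟩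
  have hC : C k * C k⁻¹ = (1 : MvPolynomial (Fin 6) ℂ) := by
    rw [← C_mul, mul_inv_cancel₀ hk, C_1]
  rw [← hdet, hq]
  linear_combination -(X 5 ^ 2 * q) * hC

end SingularSet

end E7Family

end

theorem mainTheorem2 :
    ∃ A : Matrix (Fin 7) (Fin 7) E7Family.ParamRing,
      (∀ A' : Matrix (Fin 7) (Fin 7) E7Family.ParamRing,
        E7Family.IsEliminationMatrix A' ↔ A' = A) ∧
      ∃ δ : E7Family.ParamRing,
        -- (i) the determinant of `A`
        (∃ k₀ : ℂ, k₀ ≠ 0 ∧ A.det = C k₀ * X 6 * δ) ∧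
        -- (ii) `δ = t₇⁷ + ∑_{j=1}^{7} B_j(s₃, t₁, …, t₅) t₇^{7-j}`
        (∃ B : ℕ → MvPolynomial (Fin 6) ℂ,
          δ = X 6 ^ 7 + ∑ j ∈ Finset.Icc 1 7, rename Fin.castSucc (B j) * X 6 ^ (7 - j)) ∧
        -- (iii)
        Irreducible δ ∧
        -- (iv)
        E7Family.singularParams = {p : Fin 7 → ℂ | p 6 * eval p δ = 0} ∧
        -- (v) substituting `s₃ = 0`; the variables `0, …, 5` of `δST34` are `t₁, …, t₅, t₇`
        (∃ δST34 : MvPolynomial (Fin 6) ℂ,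
          aeval (Fin.cons 0 X : Fin 7 → MvPolynomial (Fin 6) ℂ) δ = X 5 * δST34) := by
  obtain ⟨k, δ, hk, hδ, hm, hd⟩ := E7Family.exists_discriminant
  refine ⟨E7Family.elimMatrix, E7Family.isEliminationMatrix_iff, δ,
    ⟨(∏ i, (E7Family.rowScale i : ℂ)⁻¹) * k, mul_ne_zero (Finset.prod_ne_zero_iff.2 fun i _ =>
      inv_ne_zero (E7Family.rowScale_ne_zero i)) hk, ?_⟩,
    E7Family.eq_sum_of_toPoly_monic hm hd, E7Family.irreducible_discriminant hk hδ hm hd,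
    E7Family.singularParams_eq hk hδ, E7Family.exists_eq_mul_of_s_eq_zero hk hδ⟩
  rw [E7Family.det_elimMatrix, hδ, C_mul, mul_assoc, mul_assoc, mul_assoc]
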